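/- Let $G$ be a locally compact (Hausdorff) group and $H$ a compact subgroup of $G$, with probability Haar measure $dh$. Let $M(G/H)$ be the space of all regular complex Borel measures on the left coset space $G/H$, with the total variation norm $\|\lambda\|=|\lambda|(G/H)$, and let $$\mathcal{M}(G/H)=\{\lambda\in M(G/H):\ \lambda(hE)=\lambda(E)\ \text{for all } h\in H \text{ and all Borel sets } E\subseteq G/H\}.$$ For all $\lambda,\lambda'\in M(G/H)$ there are unique measures $\lambda*\lambda'\in M(G/H)$ and $\lambda^*\in M(G/H)$ such that, for every $\psi\in\mathcal{C}_0(G/H)$, $$\int_{G/H}\psi\,d(\lambda*\lambda')=\int_{G/H}\int_{G/H}\Big(\int_H\psi(xhyH)\,dh\Big)\,d\lambda(xH)\,d\lambda'(yH),$$ $$\int_{G/H}\psi\,d\lambda^*=\int_{G/H}\Big(\int_H\psi(h^{-1}x^{-1}H)\,dh\Big)\,d\overline{\lambda}(xH).$$ With the product $*$, $M(G/H)$ is a Banach algebra, and $\mathcal{M}(G/H)$ is a norm-closed subalgebra of it, closed under $\lambda\mapsto\lambda^*$. With the product $*$ and the involution $\lambda\mapsto\lambda^*$, $\mathcal{M}(G/H)$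 is a Banach $*$-algebra: it is complete, the product is bilinear and associative with $\|\lambda*\lambda'\|\le\|\lambda\|\,\|\lambda'\|$, the involution is conjugate linear, and $\lambda^{**}=\lambda$, $(\lambda*\lambda')^*=\lambda'^* * \lambda^*$ and $\|\lambda^*\|=\|\lambda\|$ for all $\lambda,\lambda'\in\mathcal{M}(G/H)$. -/

import Mathlib

open MeasureTheory

open scoped Pointwise ZeroAtInfty ComplexConjugate

noncomputable section

namespace CosetMeasure

section General

variable {X : Type*} [MeasurableSpace X]

/-- The total variation `|ν|` of a complex measure is a finite measure. -/
instance isFiniteMeasure_variation (ν : ComplexMeasure X) : IsFiniteMeasure ν.variation := by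
  have h : ν.variation ≤ (ComplexMeasure.re ν).totalVariation +
      (ComplexMeasure.im ν).totalVariation := by
    apply VectorMeasure.variation_le_of_forall_enorm_le
    intro E _
    have h1 : ‖ν E‖ₑ ≤ ‖(ν E).re‖ₑ + ‖(ν E).im‖ₑ := by
      calc ‖ν E‖ₑ = ‖((ν E).re : ℂ) + (ν E).im * Complex.I‖ₑ := by rw [Complex.re_add_im]
        _ ≤ ‖((ν E).re : ℂ)‖ₑ + ‖((ν E).im : ℂ) * Complex.I‖ₑ := enorm_add_le _ _
        _ = _ := by simp [enorm_eq_nnnorm]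
    refine h1.trans ?_
    rw [Measure.add_apply]
    exact add_le_add ((ComplexMeasure.re ν).enorm_le_totalVariation E)
      ((ComplexMeasure.im ν).enorm_le_totalVariation E)
  have : IsFiniteMeasure (ComplexMeasure.re ν).totalVariation := by
    unfold SignedMeasure.totalVariation; infer_instance
  have : IsFiniteMeasure (ComplexMeasure.im ν).totalVariation := by
    unfold SignedMeasure.totalVariation; infer_instance
  exact isFiniteMeasure_of_le _ h

/-- The integral `∫ f dν` of a complex function against a complex measure. -/
def cint (ν : ComplexMeasure X) (f : X → ℂ) : ℂ :=
  ν.integral f (ContinuousLinearMap.mul ℝ ℂ)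

/-- The complex conjugate measure `E ↦ conj (ν E)`. -/
def conjMeasure (ν : ComplexMeasure X) : ComplexMeasure X :=
  ν.mapRange (starRingEnd ℂ).toAddMonoidHom Complex.continuous_conj

variable [TopologicalSpace X] [T2Space X] [BorelSpace X]

theorem regular_of_le_add {m μ ν : Measure X} [IsFiniteMeasure μ] [IsFiniteMeasure ν]
    [μ.Regular] [ν.Regular] (h : m ≤ μ + ν) : m.Regular := by
  have hfin : IsFiniteMeasure m := isFiniteMeasure_of_le _ h
  have : m.InnerRegularCompactLTTop := by
    refine ⟨?_⟩
    rintro A ⟨hA, -⟩ r hr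
    have hsub : (μ + ν) A ≠ ⊤ := measure_ne_top _ _
    have hε : m A - r ≠ 0 := (tsub_pos_of_lt hr).ne'
    obtain ⟨K, hKA, hK, hlt⟩ := hA.exists_isCompact_sdiff_lt (μ := μ + ν) hsub hε
    refine ⟨K, hKA, hK, ?_⟩
    have h1 : m (A \ K) < m A - r := (h _).trans_lt hlt
    have h2 : m A ≤ m K + m (A \ K) := by
      rw [← measure_union_add_inter₀' hK.measurableSet.nullMeasurableSet]
      simp [Set.union_eq_self_of_subset_left hKA]
    by_contra hle
    push Not at hle
    have h3 : m A < r + (m A - r) :=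
      (h2.trans (by gcongr)).trans_lt (ENNReal.add_lt_add_left (ne_top_of_lt hr) h1)
    rw [add_tsub_cancel_of_le hr.le] at h3
    exact lt_irrefl _ h3
  infer_instance

variable (X) in
/-- The complex vector space of regular complex Borel measures on `X`. -/
def regularMeasures : Submodule ℂ (ComplexMeasure X) where
  carrier := {ν | ν.variation.Regular}
  add_mem' {a b} ha hb := by
    have : a.variation.Regular := ha
    have : b.variation.Regular := hb
    exact regular_of_le_add VectorMeasure.variation_add_le
  zero_mem' := by
    change (0 : ComplexMeasure X).variation.Regular
    rw [VectorMeasure.variation_zero]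
    infer_instance
  smul_mem' c a ha := by
    have : a.variation.Regular := ha
    change (c • a).variation.Regular
    rw [VectorMeasure.variation_smul]
    infer_instance

variable (X) in
/-- `M(X)`. -/
abbrev M : Type _ := ↥(regularMeasures X)

/-- The total variation norm `‖ν‖ = |ν|(X)`. -/
instance : Norm (M X) := ⟨fun ν => ((ν : ComplexMeasure X).variation Set.univ).toReal⟩

theorem norm_def (ν : M X) : ‖ν‖ = ((ν : ComplexMeasure X).variation Set.univ).toReal := rfl

theorem normCore : NormedSpace.Core ℂ (M X) where
  norm_nonneg _ := ENNReal.toReal_nonneg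
  norm_smul c ν := by
    simp only [norm_def, Submodule.coe_smul, VectorMeasure.variation_smul]
    simp
  norm_triangle μ ν := by
    simp only [norm_def, Submodule.coe_add]
    rw [← ENNReal.toReal_add (measure_ne_top _ _) (measure_ne_top _ _)]
    exact ENNReal.toReal_mono (by finiteness)
      (VectorMeasure.variation_add_le (μ := (μ : ComplexMeasure X)) (ν := ν) Set.univ)
  norm_eq_zero_iff ν := by
    rw [norm_def, ENNReal.toReal_eq_zero_iff]
    simp [measure_ne_top]

instance : NormedAddCommGroup (M X) := NormedAddCommGroup.ofCore normCore

instance : NormedSpace ℂ (M X) := NormedSpace.ofCore normCore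

end General

section Algebra

/-- A complex Banach space `A` with the product `mul` is a (not necessarily unital) Banach
algebra. -/
structure IsBanachAlgebra (A : Type*) [NormedAddCommGroup A] [NormedSpace ℂ A]
    (mul : A → A → A) : Prop where
  complete : CompleteSpace A
  add_mul : ∀ a b c, mul (a + b) c = mul a c + mul b c
  mul_add : ∀ a b c, mul a (b + c) = mul a b + mul a c
  smul_mul : ∀ (z : ℂ) a b, mul (z • a) b = z • mul a b
  mul_smul : ∀ (z : ℂ) a b, mul a (z • b) = z • mul a b
  mul_assoc : ∀ a b c, mul (mul a b) c = mul a (mul b c)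
  norm_mul_le : ∀ a b, ‖mul a b‖ ≤ ‖a‖ * ‖b‖

/-- A Banach algebra with an isometric conjugate-linear anti-multiplicative involution: a Banach
`*`-algebra. -/
structure IsBanachStarAlgebra (A : Type*) [NormedAddCommGroup A] [NormedSpace ℂ A]
    (mul : A → A → A) (inv : A → A) : Prop extends IsBanachAlgebra A mul where
  inv_add : ∀ a b, inv (a + b) = inv a + inv b
  inv_smul : ∀ (z : ℂ) a, inv (z • a) = conj z • inv a
  inv_inv : ∀ a, inv (inv a) = a
  inv_mul : ∀ a b, inv (mul a b) = mul (inv b) (inv a)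
  norm_inv : ∀ a, ‖inv a‖ = ‖a‖

end Algebra

section Coset

variable {G : Type*} [Group G] [TopologicalSpace G] [IsTopologicalGroup G]

instance t2Space_quotient [T2Space G] {H : Subgroup G} [CompactSpace H] : T2Space (G ⧸ H) := by
  have : IsClosed (H : Set G) := (isCompact_iff_compactSpace.mpr ‹_›).isClosed
  infer_instance

variable {H : Subgroup G} [CompactSpace H] [MeasurableSpace H] [BorelSpace H]

/-- `T_H f (xH) = ∫_H f(xh) dh`, where `dh` is the probability Haar measure of the compact
group `H`; by invariance of `dh` it depends on `xH` only. -/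
def TH (f : G → ℂ) (c : G ⧸ H) : ℂ :=
  Quotient.liftOn' c (fun x : G => ∫ h : H, f (x * h) ∂(Measure.haarMeasure ⊤)) <| by
    intro x y hxy
    rw [QuotientGroup.leftRel_apply] at hxy
    have h := integral_mul_left_eq_self
      (μ := Measure.haarMeasure (⊤ : TopologicalSpace.PositiveCompacts H))
      (fun h : H => f (x * h)) ⟨x⁻¹ * y, hxy⟩
    simpa [mul_assoc] using h.symm

theorem TH_mk (f : G → ℂ) (x : G) :
    TH f (x : G ⧸ H) = ∫ h : H, f (x * h) ∂(Measure.haarMeasure ⊤) := rfl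

variable [T2Space G] [MeasurableSpace (G ⧸ H)] [BorelSpace (G ⧸ H)]

/-- `κ` represents the convolution of `lam` and `lam'`: for every `ψ ∈ C₀(G/H)`,
`∫ ψ dκ = ∫ ∫ (∫_H ψ(xhyH) dh) d lam(xH) d lam'(yH)`. -/
def IsConv (lam lam' κ : M (G ⧸ H)) : Prop :=
  ∀ ψ : C₀(G ⧸ H, ℂ),
    cint (κ : ComplexMeasure (G ⧸ H)) ψ =
      cint (lam' : ComplexMeasure (G ⧸ H)) fun y =>
        cint (lam : ComplexMeasure (G ⧸ H)) fun x => TH (fun g : G => ψ (g • y)) x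

/-- `κ` represents the involution of `lam`: for every `ψ ∈ C₀(G/H)`,
`∫ ψ dκ = ∫ (∫_H ψ(h⁻¹x⁻¹H) dh) d (conj lam)(xH)`. -/
def IsInvol (lam κ : M (G ⧸ H)) : Prop :=
  ∀ ψ : C₀(G ⧸ H, ℂ),
    cint (κ : ComplexMeasure (G ⧸ H)) ψ =
      cint (conjMeasure (lam : ComplexMeasure (G ⧸ H)))
        (TH fun g : G => ψ ((g⁻¹ : G) : G ⧸ H))

/-- The convolution on `M(G/H)`: the regular complex measure that satisfies `IsConv`. -/
def conv (lam lam' : M (G ⧸ H)) : M (G ⧸ H) := Classical.epsilon (IsConv lam lam')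

/-- The involution on `M(G/H)`: the regular complex measure that satisfies `IsInvol`. -/
def invol (lam : M (G ⧸ H)) : M (G ⧸ H) := Classical.epsilon (IsInvol lam)

end Coset

section Invariant

variable {G : Type*} [Group G] [TopologicalSpace G] [IsTopologicalGroup G] [T2Space G]

/-- The subspace of those `lam ∈ M(G/H)` with `lam(hE) = lam(E)` for all `h ∈ H` and all Borel sets
`E`. -/
def invariantMeasures (H : Subgroup G) [CompactSpace H]
    [MeasurableSpace (G ⧸ H)] [BorelSpace (G ⧸ H)] : Submodule ℂ (M (G ⧸ H)) where
  carrier := {lam | ∀ h ∈ H, ∀ E : Set (G ⧸ H), MeasurableSet E →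
    (lam : ComplexMeasure (G ⧸ H)) (h • E) = (lam : ComplexMeasure (G ⧸ H)) E}
  add_mem' {a b} ha hb h hh E hE := by
    simp [ha h hh E hE, hb h hh E hE]
  zero_mem' h hh E hE := by simp
  smul_mem' c a ha h hh E hE := by
    simp [ha h hh E hE]

end Invariant

end CosetMeasure

end

noncomputable section

namespace CosetMeasure

/-! ### Integration against complex measures -/

section Integral

variable {X : Type*} [MeasurableSpace X]

/-! Everything is tested against `C₀(G/H)`. By regularity, compactly supported continuous functions
are dense in `L¹(|ν|)`, so a bound for the functional of `ν` on `C₀` bounds `‖ν‖`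
(`norm_le_of_forall_zeroAtInfty`). This gives uniqueness of the product and of the involution, and
turns pointwise bounds of kernels into norm bounds. For existence, the product relation is bilinear,
and the involution is a conjugation followed by a linear relation. A regular complex measure is a
combination of four positive ones (`M.induction`), so the Riesz theorem for bounded positive
functionals suffices (`exists_cint_eq_of_nonneg`).

The algebraic laws reduce to identities between the kernels `∫_H f(xhyH) dh` and `∫_H f(h⁻¹x⁻¹H)
dh`: `convKernel_convKernel` gives associativity and `convKernel_involKernel` gives the reversal of
products. Both compare double integrals over `H`, using Fubini and, for the second, the invariance
of Haar measure. The defining relations may be applied only to functions in `C₀`. The convolution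
kernel is in `C₀` for a fixed second variable, and so is its integral in the first variable
(`exists_eq_convKernel_left`, `exists_eq_cint_convKernel`), because `G → G/H` is proper and regular
finite measures are tight. Integrals are exchanged by `cint_cint_swap`, which needs no countability.

These laws hold on all of `M(G/H)`. Applying the involution kernel twice averages over left
translates by `H` (`involKernel_involKernel`). An invariant measure does not see this average, so
there the involution is involutive; being norm-decreasing, it is then isometric. Left translation
acts on a product through its left factor alone, and every `invol a` is invariant, which gives
stability of the subspace. -/

theorem cint_indicator_one (ν : ComplexMeasure X) {E : Set X} (hE : MeasurableSet E) :
    cint ν (E.indicator fun _ => 1) = ν E := by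
  have : IsFiniteMeasure (ν.variation.restrict E) := inferInstance
  rw [cint, VectorMeasure.integral_indicator_const _ hE]
  simp

theorem cint_add_measure {ν ν' : ComplexMeasure X} {f : X → ℂ} (h : Integrable f ν.variation)
    (h' : Integrable f ν'.variation) : cint (ν + ν') f = cint ν f + cint ν' f :=
  VectorMeasure.integral_add_vectorMeasure h h'

theorem cint_add {ν : ComplexMeasure X} {f g : X → ℂ} (hf : Integrable f ν.variation)
    (hg : Integrable g ν.variation) : cint ν (fun x => f x + g x) = cint ν f + cint ν g :=
  VectorMeasure.integral_fun_add hf hg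

theorem cint_sub {ν : ComplexMeasure X} {f g : X → ℂ} (hf : Integrable f ν.variation)
    (hg : Integrable g ν.variation) : cint ν (fun x => f x - g x) = cint ν f - cint ν g :=
  VectorMeasure.integral_fun_sub hf hg

theorem cint_const_mul (ν : ComplexMeasure X) (c : ℂ) (f : X → ℂ) :
    cint ν (fun x => c * f x) = c * cint ν f := by
  refine setToFun_smul (𝕜 := ℂ) _ (fun c s x => ?_) c f
  simp only [VectorMeasure.transpose]
  simp
  ring

/-- Integration against the image of a complex measure under a real linear map of `ℂ`. -/
theorem setToFun_mapRange {ν ν' : ComplexMeasure X} {f : X → ℂ} (hf : Integrable f ν.variation)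
    {K : NNReal} (h : ν'.variation ≤ K • ν.variation) (B : ℂ →L[ℝ] ℂ →L[ℝ] ℂ)
    (hB : ∀ E x, B x (ν E) = x * ν' E) :
    cint ν' f = ν.integral f B := by
  -- Both integrals extend the same set function; only the dominating measure differs, and that is
  -- changed by `setToFun_congr_measure_of_integrable`.
  have hT : ν'.transpose (ContinuousLinearMap.mul ℝ ℂ) = ν.transpose B := by
    ext E _ x
    exact (hB E x).symm
  have hd : DominatedFinMeasAdditive ν'.variation (ν.transpose B)
      ‖ContinuousLinearMap.mul ℝ ℂ‖ := by
    rw [← hT]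
    exact dominatedFinMeasAdditive_cbmApplyMeasure _ _
  have h1 : cint ν' f = setToFun ν'.variation (ν.transpose B) hd f :=
    setToFun_congr_left _ hd (by rw [hT]) f
  rw [h1]
  exact (setToFun_congr_measure_of_integrable (K : ENNReal) ENNReal.coe_ne_top h
    (dominatedFinMeasAdditive_cbmApplyMeasure ν B) hd f hf).symm

theorem cint_smul_measure (c : ℂ) {ν : ComplexMeasure X} {f : X → ℂ}
    (hf : Integrable f ν.variation) : cint (c • ν) f = c * cint ν f := by
  have h1 := VectorMeasure.continuousLinearMap_apply_integral
    (B := ContinuousLinearMap.mul ℝ ℂ) (C := ContinuousLinearMap.mul ℝ ℂ c) hf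
  refine Eq.trans ?_ h1.symm
  refine setToFun_mapRange hf (K := ‖c‖₊) (by rw [VectorMeasure.variation_smul]) _ ?_
  intro E x
  simp
  ring

theorem conjMeasure_apply (ν : ComplexMeasure X) (E : Set X) :
    conjMeasure ν E = conj (ν E) := rfl

theorem variation_conjMeasure_le (ν : ComplexMeasure X) :
    (conjMeasure ν).variation ≤ ν.variation := by
  apply VectorMeasure.variation_le_of_forall_enorm_le
  intro E _
  rw [conjMeasure_apply]
  refine le_trans (le_of_eq ?_) (VectorMeasure.enorm_measure_le_variation ν E)
  simp [enorm_eq_nnnorm]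

theorem cint_conjMeasure {ν : ComplexMeasure X} {f : X → ℂ} (hf : Integrable f ν.variation) :
    cint (conjMeasure ν) f = conj (cint ν fun x => conj (f x)) := by
  -- Conjugating the integrand and then the whole integral turns the pairing into `conj (conj x * z)
  -- = x * conj z`, which is integration against the conjugate measure.
  have h1 := VectorMeasure.continuousLinearMap_apply_integral
    (B := ContinuousLinearMap.mul ℝ ℂ ∘L Complex.conjCLE.toContinuousLinearMap)
    (C := Complex.conjCLE.toContinuousLinearMap) hf
  have h2 := VectorMeasure.integral_continuousLinearMap_comp (B := ContinuousLinearMap.mul ℝ ℂ)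
    (C := Complex.conjCLE.toContinuousLinearMap) hf
  rw [← h2] at h1
  refine Eq.trans ?_ h1.symm
  refine setToFun_mapRange hf (K := 1) (by simpa using variation_conjMeasure_le ν) _ ?_
  intro E x
  simp [conjMeasure_apply]

theorem norm_cint_le (ν : ComplexMeasure X) {f : X → ℂ} {C : ℝ} (hf : ∀ x, ‖f x‖ ≤ C) :
    ‖cint ν f‖ ≤ C * (ν.variation Set.univ).toReal := by
  have := VectorMeasure.norm_integral_le_of_norm_le_const (μ := ν)
    (B := ContinuousLinearMap.mul ℝ ℂ) (f := f) (C := C) (.of_forall hf)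
  simpa [cint, measureReal_def] using this

theorem norm_cint_le_integral (ν : ComplexMeasure X) (f : X → ℂ) :
    ‖cint ν f‖ ≤ ∫ x, ‖f x‖ ∂ν.variation := by
  have := VectorMeasure.norm_integral_le_integral_norm (μ := ν)
    (B := ContinuousLinearMap.mul ℝ ℂ) (f := f)
  simpa [cint] using this

/-- The complex measure given by a finite measure. -/
def complexOfMeasure (μ : Measure X) [IsFiniteMeasure μ] : ComplexMeasure X :=
  μ.toSignedMeasure.toComplexMeasure 0

theorem complexOfMeasure_apply (μ : Measure X) [IsFiniteMeasure μ] {E : Set X}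
    (hE : MeasurableSet E) : complexOfMeasure μ E = (μ.real E : ℂ) := by
  rw [complexOfMeasure, SignedMeasure.toComplexMeasure_apply,
    Measure.toSignedMeasure_apply_measurable hE]
  rfl

theorem variation_complexOfMeasure (μ : Measure X) [IsFiniteMeasure μ] :
    (complexOfMeasure μ).variation = μ := by
  apply le_antisymm
  · apply VectorMeasure.variation_le_of_forall_enorm_le
    intro E hE
    rw [complexOfMeasure_apply _ hE]
    rw [← ofReal_norm, Complex.norm_real, Real.norm_of_nonneg measureReal_nonneg, measureReal_def,
      ENNReal.ofReal_toReal (measure_ne_top _ _)]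
  · refine Measure.le_iff.2 fun E hE => ?_
    refine le_trans (le_of_eq ?_) (VectorMeasure.enorm_measure_le_variation _ E)
    rw [complexOfMeasure_apply _ hE]
    rw [← ofReal_norm, Complex.norm_real, Real.norm_of_nonneg measureReal_nonneg, measureReal_def,
      ENNReal.ofReal_toReal (measure_ne_top _ _)]

theorem cint_complexOfMeasure (μ : Measure X) [IsFiniteMeasure μ] (f : X → ℂ) :
    cint (complexOfMeasure μ) f = ∫ x, f x ∂μ := by
  rw [cint, VectorMeasure.integral_eq_setToFun, MeasureTheory.integral_eq_setToFun]
  simp only [variation_complexOfMeasure]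
  apply setToFun_congr_left' _ _ (fun s hs h's ↦ ?_)
  ext
  simp [VectorMeasure.transpose, complexOfMeasure_apply _ hs, weightedSMul]

end Integral

/-! ### Bounded continuous functions and `C₀` -/

section BoundedContinuous

variable {X : Type*} [TopologicalSpace X]

/-- A bounded continuous function. -/
def IsBC (f : X → ℂ) : Prop :=
  Continuous f ∧ ∃ C, ∀ y, ‖f y‖ ≤ C

theorem IsBC.integrable [MeasurableSpace X] [BorelSpace X] {f : X → ℂ} (hf : IsBC f)
    (μ : Measure X) [IsFiniteMeasure μ] : Integrable f μ := by
  obtain ⟨hc, C, hC⟩ := hf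
  exact .of_bound hc.aestronglyMeasurable C (.of_forall hC)

theorem norm_apply_le_norm_zeroAtInfty (ψ : C₀(X, ℂ)) (x : X) : ‖ψ x‖ ≤ ‖ψ‖ := by
  rw [← ZeroAtInftyContinuousMap.norm_toBCF_eq_norm]
  exact ψ.toBCF.norm_coe_le_norm x

theorem norm_zeroAtInfty_le {ψ : C₀(X, ℂ)} {C : ℝ} (hC : 0 ≤ C) (h : ∀ x, ‖ψ x‖ ≤ C) :
    ‖ψ‖ ≤ C := by
  rw [← ZeroAtInftyContinuousMap.norm_toBCF_eq_norm]
  exact (BoundedContinuousFunction.norm_le hC).2 h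

theorem IsBC.zeroAtInfty (ψ : C₀(X, ℂ)) : IsBC ψ :=
  ⟨map_continuous ψ, ‖ψ‖, norm_apply_le_norm_zeroAtInfty ψ⟩

end BoundedContinuous

/-! ### Regular complex measures: decomposition, completeness, duality with `C₀` -/

section Regular

variable {X : Type*} [MeasurableSpace X] [TopologicalSpace X] [T2Space X] [BorelSpace X]

instance regular_variation (ν : M X) : (ν : ComplexMeasure X).variation.Regular := ν.2

/-- The element of `M(X)` given by a finite regular measure. -/
def ofMeasure (μ : Measure X) [IsFiniteMeasure μ] [μ.Regular] : M X :=
  ⟨complexOfMeasure μ, by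
    change (complexOfMeasure μ).variation.Regular
    rw [variation_complexOfMeasure]
    infer_instance⟩

theorem cint_ofMeasure (μ : Measure X) [IsFiniteMeasure μ] [μ.Regular] (f : X → ℂ) :
    cint (ofMeasure μ : ComplexMeasure X) f = ∫ x, f x ∂μ :=
  cint_complexOfMeasure μ f

/-- The Jordan parts of the real and imaginary parts are dominated by `|ν|`, and hence inherit its
regularity. -/
theorem M.exists_eq_ofMeasure (ν : M X) : ∃ μ : Fin 4 → Measure X,
    ∃ (_ : ∀ i, IsFiniteMeasure (μ i)) (_ : ∀ i, (μ i).Regular),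
      ν = ofMeasure (μ 0) + (-1 : ℂ) • ofMeasure (μ 1) + Complex.I • ofMeasure (μ 2) +
        (-Complex.I) • ofMeasure (μ 3) := by
  have key : ∀ s : SignedMeasure X, s.variation ≤ (ν : ComplexMeasure X).variation →
      s.toJordanDecomposition.posPart.Regular ∧ s.toJordanDecomposition.negPart.Regular := by
    intro s hs
    rw [← SignedMeasure.totalVariation_eq_variation] at hs
    have h1 : s.toJordanDecomposition.posPart ≤
        (ν : ComplexMeasure X).variation + (ν : ComplexMeasure X).variation :=
      (Measure.le_add_right le_rfl).trans (hs.trans (Measure.le_add_right le_rfl))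
    have h2 : s.toJordanDecomposition.negPart ≤
        (ν : ComplexMeasure X).variation + (ν : ComplexMeasure X).variation :=
      (Measure.le_add_left le_rfl).trans (hs.trans (Measure.le_add_right le_rfl))
    exact ⟨regular_of_le_add h1, regular_of_le_add h2⟩
  have hre : (ComplexMeasure.re (ν : ComplexMeasure X)).variation ≤
      (ν : ComplexMeasure X).variation := by
    apply VectorMeasure.variation_le_of_forall_enorm_le
    intro E _
    refine le_trans ?_ (VectorMeasure.enorm_measure_le_variation _ E)
    rw [enorm_le_iff_norm_le]
    exact Complex.abs_re_le_norm _
  have him : (ComplexMeasure.im (ν : ComplexMeasure X)).variation ≤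
      (ν : ComplexMeasure X).variation := by
    apply VectorMeasure.variation_le_of_forall_enorm_le
    intro E _
    refine le_trans ?_ (VectorMeasure.enorm_measure_le_variation _ E)
    rw [enorm_le_iff_norm_le]
    exact Complex.abs_im_le_norm _
  obtain ⟨h1, h2⟩ := key _ hre
  obtain ⟨h3, h4⟩ := key _ him
  set s := ComplexMeasure.re (ν : ComplexMeasure X) with hs
  set t := ComplexMeasure.im (ν : ComplexMeasure X) with ht
  refine ⟨![s.toJordanDecomposition.posPart, s.toJordanDecomposition.negPart,
    t.toJordanDecomposition.posPart, t.toJordanDecomposition.negPart], ?_, ?_, ?_⟩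
  · intro i
    fin_cases i <;> simp <;> infer_instance
  · intro i
    fin_cases i <;> simp <;> assumption
  · refine Subtype.ext (VectorMeasure.ext fun E hE => ?_)
    have e1 := s.apply_eq_posPart_real_sub_negPart_real hE
    have e2 := t.apply_eq_posPart_real_sub_negPart_real hE
    have e3 : (ν : ComplexMeasure X) E = (s E : ℂ) + (t E : ℂ) * Complex.I :=
      (Complex.re_add_im _).symm
    rw [e3, e1, e2]
    simp only [ofMeasure, Submodule.coe_add, Submodule.coe_smul, add_apply,
      smul_apply, complexOfMeasure_apply _ hE]
    simp
    ring

/-- A property of regular complex measures holds for all of them if it holds for positive ones and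
is stable under linear combinations. -/
theorem M.induction {P : M X → Prop}
    (hpos : ∀ (μ : Measure X) [IsFiniteMeasure μ] [μ.Regular], P (ofMeasure μ))
    (hadd : ∀ a b, P a → P b → P (a + b)) (hsmul : ∀ (c : ℂ) a, P a → P (c • a)) (ν : M X) :
    P ν := by
  obtain ⟨μ, h1, h2, rfl⟩ := M.exists_eq_ofMeasure ν
  exact hadd _ _ (hadd _ _ (hadd _ _ (hpos _) (hsmul _ _ (hpos _))) (hsmul _ _ (hpos _)))
    (hsmul _ _ (hpos _))

theorem norm_apply_le_norm (ν : M X) (E : Set X) : ‖(ν : ComplexMeasure X) E‖ ≤ ‖ν‖ := by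
  refine (VectorMeasure.norm_measure_le_variation (measure_ne_top _ _)).trans ?_
  rw [norm_def]
  exact ENNReal.toReal_mono (measure_ne_top _ _) (measure_mono (Set.subset_univ _))

theorem continuous_apply (E : Set X) : Continuous fun ν : M X => (ν : ComplexMeasure X) E := by
  let L : M X →ₗ[ℂ] ℂ :=
    { toFun := fun ν => (ν : ComplexMeasure X) E
      map_add' := fun _ _ => rfl
      map_smul' := fun _ _ => rfl }
  exact (L.mkContinuous 1 fun ν => by
    rw [one_mul]
    exact norm_apply_le_norm ν E).continuous

theorem summable_apply {u : ℕ → M X} (hu : Summable fun n => ‖u n‖) (E : Set X) :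
    Summable fun n => (u n : ComplexMeasure X) E :=
  .of_norm_bounded hu fun _ => norm_apply_le_norm _ _

/-- The sum of an absolutely convergent series of complex measures. -/
def seriesMeasure {u : ℕ → M X} (hu : Summable fun n => ‖u n‖) : ComplexMeasure X where
  measureOf' E := ∑' n, (u n : ComplexMeasure X) E
  empty' := by simp
  not_measurable' E hE := by simp [VectorMeasure.not_measurable _ hE]
  m_iUnion' f hf hd := by
    -- A finite partial sum over the sets is the series evaluated on a finite union; dominated
    -- convergence in `n`, with bound `‖u n‖`, then gives countable additivity.
    have h : ∀ s : Finset ℕ, ∑ i ∈ s, ∑' n, (u n : ComplexMeasure X) (f i) =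
        ∑' n, (u n : ComplexMeasure X) (⋃ i ∈ s, f i) := by
      intro s
      rw [← Summable.tsum_finsetSum fun i _ => summable_apply hu _]
      congr 1 with n
      exact (VectorMeasure.of_biUnion_finset (fun i _ j _ hij => hd hij) fun i _ => hf i).symm
    unfold HasSum
    simp only [SummationFilter.unconditional_filter, h]
    refine tendsto_tsum_of_dominated_convergence hu (fun n => ?_)
      (.of_forall fun s n => norm_apply_le_norm _ _)
    have := VectorMeasure.hasSum_of_disjoint_iUnion (v := (u n : ComplexMeasure X)) hf hd
    unfold HasSum at this
    simp only [SummationFilter.unconditional_filter] at this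
    refine this.congr fun s => ?_
    exact (VectorMeasure.of_biUnion_finset (fun i _ j _ hij => hd hij) fun i _ => hf i).symm

theorem seriesMeasure_apply {u : ℕ → M X} (hu : Summable fun n => ‖u n‖) (E : Set X) :
    seriesMeasure hu E = ∑' n, (u n : ComplexMeasure X) E := rfl

theorem variation_seriesMeasure_le {u : ℕ → M X} (hu : Summable fun n => ‖u n‖) :
    (seriesMeasure hu).variation ≤ Measure.sum fun n => (u n : ComplexMeasure X).variation := by
  apply VectorMeasure.variation_le_of_forall_enorm_le
  intro E hE
  rw [seriesMeasure_apply, Measure.sum_apply _ hE]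
  have hs : Summable fun n => ‖(u n : ComplexMeasure X) E‖ :=
    .of_nonneg_of_le (fun _ => norm_nonneg _) (fun n => norm_apply_le_norm _ _) hu
  refine (enorm_tsum_le_tsum_enorm).trans ?_
  exact ENNReal.tsum_le_tsum fun n => VectorMeasure.enorm_measure_le_variation _ _

theorem sum_variation_univ {u : ℕ → M X} (hu : Summable fun n => ‖u n‖) :
    (Measure.sum fun n => (u n : ComplexMeasure X).variation) Set.univ =
      ENNReal.ofReal (∑' n, ‖u n‖) := by
  rw [Measure.sum_apply _ .univ, ENNReal.ofReal_tsum_of_nonneg (fun _ => norm_nonneg _) hu]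
  congr 1 with n
  rw [norm_def, ENNReal.ofReal_toReal (measure_ne_top _ _)]

theorem regular_variation_seriesMeasure {u : ℕ → M X} (hu : Summable fun n => ‖u n‖) :
    (seriesMeasure hu).variation.Regular := by
  have : IsFiniteMeasure (Measure.sum fun n => (u n : ComplexMeasure X).variation) :=
    ⟨by rw [sum_variation_univ hu]; exact ENNReal.ofReal_lt_top⟩
  have h : (seriesMeasure hu).variation ≤
      (Measure.sum fun n => (u n : ComplexMeasure X).variation) + 0 := by
    simpa using variation_seriesMeasure_le hu
  exact regular_of_le_add h

/-- It suffices to sum absolutely convergent series. The setwise sum has variation at most the sum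
of the variations; this yields both its regularity and, applied to the tail, convergence in norm. -/
instance completeSpace_M : CompleteSpace (M X) := by
  refine NormedAddCommGroup.completeSpace_of_summable_imp_tendsto fun u hu => ?_
  refine ⟨⟨seriesMeasure hu, regular_variation_seriesMeasure hu⟩, ?_⟩
  rw [tendsto_iff_norm_sub_tendsto_zero]
  have h0 := tendsto_sum_nat_add fun n => ‖u n‖
  refine squeeze_zero (fun _ => norm_nonneg _) (fun N => ?_) h0
  have huN : Summable fun n => ‖u (n + N)‖ := (summable_nat_add_iff N).2 hu
  have e : (seriesMeasure hu : ComplexMeasure X) =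
      ((∑ i ∈ Finset.range N, u i : M X) : ComplexMeasure X) + seriesMeasure huN := by
    refine VectorMeasure.ext fun E _ => ?_
    rw [add_apply, seriesMeasure_apply, seriesMeasure_apply,
      ← (summable_apply hu E).sum_add_tsum_nat_add N]
    congr 1
    exact (map_sum (⟨⟨fun ν : M X => (ν : ComplexMeasure X) E, rfl⟩, fun _ _ => rfl⟩ : M X →+ ℂ)
      u _).symm
  rw [norm_sub_rev, norm_def]
  simp only [Submodule.coe_sub]
  rw [e, add_sub_cancel_left]
  refine (ENNReal.toReal_mono ?_ (variation_seriesMeasure_le huN _)).trans ?_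
  · rw [sum_variation_univ huN]; exact ENNReal.ofReal_ne_top
  · rw [sum_variation_univ huN, ENNReal.toReal_ofReal (tsum_nonneg fun _ => norm_nonneg _)]

/-- The radial retraction of `ℂ` onto the closed unit disc. -/
def diskRetract (z : ℂ) : ℂ := ((max 1 ‖z‖ : ℝ) : ℂ)⁻¹ * z

theorem continuous_diskRetract : Continuous diskRetract := by
  unfold diskRetract
  refine Continuous.mul (Continuous.inv₀ (by fun_prop) fun z => ?_) continuous_id
  have : (0 : ℝ) < max 1 ‖z‖ := by positivity
  exact_mod_cast this.ne'

theorem norm_diskRetract_le (z : ℂ) : ‖diskRetract z‖ ≤ 1 := by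
  have h : (0 : ℝ) < max 1 ‖z‖ := by positivity
  rw [diskRetract, norm_mul, norm_inv, Complex.norm_real, Real.norm_of_nonneg h.le,
    inv_mul_le_iff₀ h, mul_one]
  exact le_max_right _ _

/-- The retraction moves a point outside the disc by `‖z‖ - 1`, which is at most `‖u - z‖`; the
triangle inequality costs the factor 2. -/
theorem norm_sub_diskRetract_le {u z : ℂ} (hu : ‖u‖ ≤ 1) :
    ‖u - diskRetract z‖ ≤ 2 * ‖u - z‖ := by
  have h : ‖z - diskRetract z‖ ≤ ‖u - z‖ := by
    rcases le_total ‖z‖ 1 with hz | hz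
    · simp [diskRetract, max_eq_left hz]
    · have h0 : (0 : ℝ) < ‖z‖ := by linarith
      have e : z - diskRetract z = ((1 - ‖z‖⁻¹ : ℝ) : ℂ) * z := by
        simp [diskRetract, max_eq_right hz]; ring
      have h1 : 0 ≤ 1 - ‖z‖⁻¹ := by
        rw [sub_nonneg]; exact inv_le_one_of_one_le₀ hz
      rw [e, norm_mul, Complex.norm_real, Real.norm_of_nonneg h1, sub_mul,
        inv_mul_cancel₀ h0.ne']
      have := norm_sub_norm_le z u
      rw [norm_sub_rev] at this
      linarith
  calc ‖u - diskRetract z‖ = ‖(u - z) + (z - diskRetract z)‖ := by congr 1; ring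
    _ ≤ ‖u - z‖ + ‖z - diskRetract z‖ := norm_add_le _ _
    _ ≤ 2 * ‖u - z‖ := by linarith

/-- A finite family of disjoint sets is normed, up to `ε`, by a function of modulus at most one. -/
theorem exists_norm_le_cint (ν : M X) {ε : NNReal} (hε : 0 < ε) :
    ∃ u : X → ℂ, Measurable u ∧ (∀ x, ‖u x‖ ≤ 1) ∧
      ‖ν‖ ≤ ‖cint (ν : ComplexMeasure X) u‖ + ε := by
  classical
  obtain ⟨P, -, hPd, hPm, hP⟩ := VectorMeasure.exists_variation_le_add (ν : ComplexMeasure X)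
    MeasurableSet.univ hε (measure_ne_top _ _)
  -- The phase that rotates the mass of each piece onto the positive axis.
  have hc : ∀ z : ℂ, ∃ c : ℂ, ‖c‖ ≤ 1 ∧ c * z = ‖z‖ := by
    intro z
    rcases eq_or_ne z 0 with rfl | hz
    · exact ⟨0, by simp⟩
    · refine ⟨conj z / ‖z‖, by simp [hz], ?_⟩
      have : (‖z‖ : ℂ) ≠ 0 := by simpa using hz
      field_simp
      rw [mul_comm, Complex.mul_conj, Complex.normSq_eq_norm_sq]
      push_cast; ring
  choose c hc1 hc2 using hc
  let u : X → ℂ := fun x => ∑ p ∈ P, c ((ν : ComplexMeasure X) p) * p.indicator (fun _ => 1) x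
  have h_int : ∀ p ∈ P, Integrable
      (fun x => c ((ν : ComplexMeasure X) p) * p.indicator (fun _ => (1 : ℂ)) x)
      (ν : ComplexMeasure X).variation := fun p hp =>
    ((integrable_const _).indicator (hPm p hp)).const_mul _
  have hu : cint (ν : ComplexMeasure X) u = ((∑ p ∈ P, ‖(ν : ComplexMeasure X) p‖ : ℝ) : ℂ) := by
    have := VectorMeasure.integral_finsetSum (B := ContinuousLinearMap.mul ℝ ℂ) P h_int
    rw [cint, show u = fun x => ∑ p ∈ P, c ((ν : ComplexMeasure X) p) *
      p.indicator (fun _ => 1) x from rfl, this]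
    push_cast
    refine Finset.sum_congr rfl fun p hp => ?_
    rw [← hc2]
    exact (cint_const_mul _ _ _).trans (by rw [cint_indicator_one _ (hPm p hp)])
  refine ⟨u, ?_, ?_, ?_⟩
  · exact Finset.measurable_fun_sum _ fun p hp =>
      measurable_const.mul (measurable_const.indicator (hPm p hp))
  · intro x
    by_cases hx : ∃ p ∈ P, x ∈ p
    · obtain ⟨p, hp, hxp⟩ := hx
      have : u x = c ((ν : ComplexMeasure X) p) := by
        change ∑ q ∈ P, _ = _
        rw [Finset.sum_eq_single_of_mem p hp]
        · simp [hxp]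
        · intro q hq hqp
          have : x ∉ q := fun hxq =>
            Set.disjoint_left.1 (hPd hq hp hqp) hxq hxp
          simp [this]
      rw [this]
      exact hc1 _
    · push Not at hx
      have : u x = 0 := Finset.sum_eq_zero fun p hp => by simp [hx p hp]
      rw [this]; simp
  · rw [hu, Complex.norm_real, Real.norm_of_nonneg (Finset.sum_nonneg fun _ _ => norm_nonneg _),
      norm_def]
    have hfin : ∑ p ∈ P, ‖(ν : ComplexMeasure X) p‖ₑ ≠ ⊤ :=
      (ENNReal.sum_lt_top.2 fun _ _ => enorm_lt_top).ne
    refine (ENNReal.toReal_mono (by finiteness) hP).trans (le_of_eq ?_)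
    rw [ENNReal.toReal_add hfin (by finiteness), ENNReal.toReal_sum fun _ _ => enorm_ne_top]
    simp

/-- In a locally compact Hausdorff space, an integrable function is approximated by compactly
supported continuous functions in the mean. -/
theorem exists_hasCompactSupport_integral_sub_le [LocallyCompactSpace X] {μ : Measure X}
    [IsFiniteMeasure μ] [μ.Regular] {f : X → ℂ} (hf : Integrable f μ) {ε : ℝ} (hε : 0 < ε) :
    ∃ g : X → ℂ, HasCompactSupport g ∧ ∫ x, ‖f x - g x‖ ∂μ ≤ ε ∧ Continuous g := by
  have key : ∃ g : X → ℂ, eLpNorm (f - g) 1 μ ≤ ENNReal.ofReal ε ∧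
      (Continuous g ∧ HasCompactSupport g) := by
    refine (memLp_one_iff_integrable.2 hf).induction_dense ENNReal.one_ne_top
      (fun g => Continuous g ∧ HasCompactSupport g) ?_ ?_ ?_
      (ENNReal.ofReal_pos.2 hε).ne'
    · intro c E hE _ δ hδ
      -- With `K ⊆ E` and `K ⊆ V`, the cutoff of `K` inside `V` differs from the indicator of `E`
      -- only on `E \ K` and `V \ K`. Each contributes at most `δ / 2`; the `+ 1` covers `c = 0`.
      have hη : δ / (2 * (‖c‖ₑ + 1)) ≠ 0 := by
        refine (ENNReal.div_pos hδ ?_).ne'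
        finiteness
      obtain ⟨K, hKE, hK, hKlt⟩ := hE.exists_isCompact_sdiff_lt (measure_ne_top μ _) hη
      obtain ⟨V, hKV, hV, -, hVlt⟩ :=
        hK.measurableSet.exists_isOpen_sdiff_lt (measure_ne_top μ _) hη
      obtain ⟨φ, hφ1, hφ0, hφs, hφr⟩ := exists_continuous_one_zero_of_isCompact hK
        hV.isClosed_compl (Set.disjoint_compl_right_iff_subset.2 hKV)
      refine ⟨fun x => (φ x : ℂ) * c, ?_, by fun_prop, ?_⟩
      · rw [eLpNorm_one_eq_lintegral_enorm]
        calc ∫⁻ x, ‖((fun x => (φ x : ℂ) * c) - E.indicator fun _ => c) x‖ₑ ∂μ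
            ≤ ∫⁻ x, ((E \ K).indicator (fun _ => ‖c‖ₑ) x + (V \ K).indicator (fun _ => ‖c‖ₑ) x)
                ∂μ := by
              refine lintegral_mono fun x => ?_
              by_cases hxK : x ∈ K
              · have : φ x = 1 := hφ1 hxK
                simp [this, hKE hxK]
              · have hle : ‖(φ x : ℂ) * c‖ₑ ≤ (V \ K).indicator (fun _ => ‖c‖ₑ) x := by
                  by_cases hxV : x ∈ V
                  · rw [Set.indicator_of_mem (s := V \ K) ⟨hxV, hxK⟩, enorm_le_iff_norm_le, norm_mul,
                      Complex.norm_real, Real.norm_of_nonneg (hφr x).1]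
                    exact mul_le_of_le_one_left (norm_nonneg _) (hφr x).2
                  · have : φ x = 0 := hφ0 hxV
                    simp [this]
                have hE' : ‖E.indicator (fun _ => c) x‖ₑ = (E \ K).indicator (fun _ => ‖c‖ₑ) x := by
                  by_cases hxE : x ∈ E <;> simp [hxE, hxK]
                rw [Pi.sub_apply]
                refine (enorm_sub_le).trans ?_
                rw [hE', add_comm]
                gcongr
          _ = ‖c‖ₑ * μ (E \ K) + ‖c‖ₑ * μ (V \ K) := by
              rw [lintegral_add_left (measurable_const.indicator (hE.diff hK.measurableSet)),
                lintegral_indicator_const (hE.diff hK.measurableSet),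
                lintegral_indicator_const (hV.measurableSet.diff hK.measurableSet)]
          _ ≤ (‖c‖ₑ + 1) * (δ / (2 * (‖c‖ₑ + 1))) + (‖c‖ₑ + 1) * (δ / (2 * (‖c‖ₑ + 1))) := by
              gcongr <;> exact le_self_add
          _ = 2 * (‖c‖ₑ + 1) * (δ / (2 * (‖c‖ₑ + 1))) := by ring
          _ ≤ δ := ENNReal.mul_div_le
      · exact HasCompactSupport.mul_right (hφs.comp_left (g := fun r : ℝ => (r : ℂ)) (by simp))
    · exact fun f g hf hg => ⟨hf.1.add hg.1, hf.2.add hg.2⟩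
    · exact fun f hf => hf.1.aestronglyMeasurable
  obtain ⟨g, hg, hgc, hgs⟩ := key
  refine ⟨g, hgs, ?_, hgc⟩
  have hgi : Integrable g μ := hgc.integrable_of_hasCompactSupport hgs
  rw [eLpNorm_one_eq_lintegral_enorm] at hg
  change ∫ x, ‖(f - g) x‖ ∂μ ≤ ε
  rw [integral_norm_eq_lintegral_enorm (hf.sub hgi).aestronglyMeasurable]
  exact ENNReal.toReal_le_of_le_ofReal hε.le hg

/-- A measurable function of modulus at most one nearly attains the norm. It is approximated in
`L¹(|ν|)` by a compactly supported continuous function, which `diskRetract` brings into the unit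
ball of `C₀`. The norming costs `δ / 3` and the approximation `2 * (δ / 3)`. -/
theorem norm_le_of_forall_zeroAtInfty [LocallyCompactSpace X] (ν : M X) {C : ℝ} (hC : 0 ≤ C)
    (h : ∀ ψ : C₀(X, ℂ), ‖cint (ν : ComplexMeasure X) ψ‖ ≤ C * ‖ψ‖) : ‖ν‖ ≤ C := by
  refine le_of_forall_pos_le_add fun δ hδ => ?_
  obtain ⟨ε, hε, hεδ⟩ : ∃ ε : NNReal, 0 < ε ∧ (ε : ℝ) = δ / 3 :=
    ⟨(δ / 3).toNNReal, by simpa using hδ, Real.coe_toNNReal _ (by positivity)⟩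
  obtain ⟨u, hum, hu1, hu⟩ := exists_norm_le_cint ν hε
  have hui : Integrable u (ν : ComplexMeasure X).variation :=
    .of_bound hum.aestronglyMeasurable 1 (.of_forall hu1)
  obtain ⟨g, hgs, hg, hgc⟩ := exists_hasCompactSupport_integral_sub_le hui
    (ε := δ / 3) (by positivity)
  have hgi : Integrable g (ν : ComplexMeasure X).variation :=
    hgc.integrable_of_hasCompactSupport hgs
  have hψc : Continuous fun x => diskRetract (g x) := continuous_diskRetract.comp hgc
  have hψs : HasCompactSupport fun x => diskRetract (g x) :=
    hgs.comp_left (g := diskRetract) (by simp [diskRetract])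
  obtain ⟨ψ, hψ⟩ : ∃ ψ : C₀(X, ℂ), ∀ x, ψ x = diskRetract (g x) :=
    ⟨⟨⟨fun x => diskRetract (g x), hψc⟩, hψs.is_zero_at_infty⟩, fun _ => rfl⟩
  have hψ1 : ‖ψ‖ ≤ 1 :=
    norm_zeroAtInfty_le zero_le_one fun x => (hψ x).symm ▸ norm_diskRetract_le _
  have hψi := (IsBC.zeroAtInfty ψ).integrable (ν : ComplexMeasure X).variation
  have h1 : ‖cint (ν : ComplexMeasure X) u - cint (ν : ComplexMeasure X) ψ‖ ≤ 2 * (δ / 3) := by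
    rw [← cint_sub hui hψi]
    refine (norm_cint_le_integral _ _).trans ?_
    calc ∫ x, ‖u x - ψ x‖ ∂(ν : ComplexMeasure X).variation
        ≤ ∫ x, 2 * ‖u x - g x‖ ∂(ν : ComplexMeasure X).variation := by
          refine integral_mono (hui.sub hψi).norm ((hui.sub hgi).norm.const_mul 2) fun x => ?_
          simp only [hψ]
          exact norm_sub_diskRetract_le (hu1 x)
      _ ≤ 2 * (δ / 3) := by
          rw [integral_const_mul]
          gcongr
  have h2 : ‖cint (ν : ComplexMeasure X) ψ‖ ≤ C :=
    (h ψ).trans (mul_le_of_le_one_right hC hψ1)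
  have h3 := norm_le_norm_add_norm_sub' (cint (ν : ComplexMeasure X) u)
    (cint (ν : ComplexMeasure X) ψ)
  linarith

theorem ext_of_forall_zeroAtInfty [LocallyCompactSpace X] {ν ν' : M X}
    (h : ∀ ψ : C₀(X, ℂ), cint (ν : ComplexMeasure X) ψ = cint (ν' : ComplexMeasure X) ψ) :
    ν = ν' := by
  rw [← sub_eq_zero, ← norm_le_zero_iff]
  refine norm_le_of_forall_zeroAtInfty _ le_rfl fun ψ => ?_
  have hi := fun ν : M X => (IsBC.zeroAtInfty ψ).integrable (ν : ComplexMeasure X).variation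
  have e : ((ν - ν' : M X) : ComplexMeasure X) = ν + ((-1 : ℂ) • ν' : M X) := by
    simp [sub_eq_add_neg]
  rw [e, cint_add_measure (hi _) (hi _), Submodule.coe_smul, cint_smul_measure _ (hi _), h]
  simp

end Regular

/-! ### Sections, products and cutoffs of bounded continuous functions -/

section BoundedContinuous

variable {X : Type*} [TopologicalSpace X] {Y : Type*} [TopologicalSpace Y]

theorem IsBC.comp {f : X → ℂ} (hf : IsBC f) {g : Y → X} (hg : Continuous g) :
    IsBC fun y => f (g y) :=
  ⟨hf.1.comp hg, hf.2.imp fun _ h y => h (g y)⟩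

theorem IsBC.left {F : X → Y → ℂ} (hF : IsBC (Function.uncurry F)) (y : Y) :
    IsBC fun x => F x y :=
  hF.comp (by fun_prop : Continuous fun x => (x, y))

theorem IsBC.right {F : X → Y → ℂ} (hF : IsBC (Function.uncurry F)) (x : X) : IsBC (F x) :=
  hF.comp (by fun_prop : Continuous fun y => (x, y))

theorem IsBC.flip {F : X → Y → ℂ} (hF : IsBC (Function.uncurry F)) :
    IsBC (Function.uncurry fun y x => F x y) :=
  hF.comp (by fun_prop : Continuous fun p : Y × X => (p.2, p.1))

theorem IsBC.mul {f g : X → ℂ} (hf : IsBC f) (hg : IsBC g) :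
    IsBC fun z => f z * g z := by
  obtain ⟨hfc, C, hC⟩ := hf
  obtain ⟨hgc, D, hD⟩ := hg
  refine ⟨hfc.mul hgc, C * D, fun z => ?_⟩
  rw [norm_mul]
  exact mul_le_mul (hC z) (hD z) (norm_nonneg _) ((norm_nonneg _).trans (hC z))

/-- A cutoff function for a compact set. -/
theorem exists_cutoff [T2Space X] [LocallyCompactSpace X]
    {K : Set X} (hK : IsCompact K) : ∃ φ : X → ℝ, Continuous φ ∧ HasCompactSupport φ ∧
      (∀ z ∈ K, φ z = 1) ∧ ∀ z, 0 ≤ φ z ∧ φ z ≤ 1 := by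
  obtain ⟨φ, h1, -, hs, hr⟩ := exists_continuous_one_zero_of_isCompact hK isClosed_empty
    (Set.disjoint_empty _)
  exact ⟨φ, φ.continuous, hs, fun z hz => h1 hz, hr⟩

end BoundedContinuous

/-! ### Parameter integrals and Fubini without countability -/

section Parametric

variable {X : Type*} [MeasurableSpace X] [TopologicalSpace X] [T2Space X] [BorelSpace X]
  {Y : Type*} [TopologicalSpace Y]

theorem cint_add_measure_of_isBC {ν ν' : M X} {f : X → ℂ} (hf : IsBC f) :
    cint ((ν + ν' : M X) : ComplexMeasure X) f =
      cint (ν : ComplexMeasure X) f + cint (ν' : ComplexMeasure X) f :=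
  cint_add_measure (hf.integrable _) (hf.integrable _)

theorem cint_smul_measure_of_isBC (c : ℂ) {ν : M X} {f : X → ℂ} (hf : IsBC f) :
    cint ((c • ν : M X) : ComplexMeasure X) f = c * cint (ν : ComplexMeasure X) f :=
  cint_smul_measure c (hf.integrable _)

theorem norm_cint_le_norm (ν : M X) {f : X → ℂ} {C : ℝ} (hf : ∀ x, ‖f x‖ ≤ C) :
    ‖cint (ν : ComplexMeasure X) f‖ ≤ C * ‖ν‖ :=
  norm_cint_le _ hf

theorem exists_isCompact_compl_le (μ : Measure X) [IsFiniteMeasure μ] [μ.Regular] {ε : ℝ}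
    (hε : 0 < ε) : ∃ K : Set X, IsCompact K ∧ μ.real Kᶜ ≤ ε := by
  obtain ⟨K, -, hK, h⟩ := MeasurableSet.univ.exists_isCompact_sdiff_lt (measure_ne_top μ _)
    (ENNReal.ofReal_pos.2 hε).ne'
  refine ⟨K, hK, ENNReal.toReal_le_of_le_ofReal hε.le ?_⟩
  rw [Set.compl_eq_univ_sdiff]
  exact h.le

/-- An integral is estimated separately on a compact set and on its complement. -/
theorem norm_cint_le_of_isCompact (ν : M X) {K : Set X} (hK : IsCompact K) {f : X → ℂ} {a b : ℝ}
    (ha : ∀ x ∈ K, ‖f x‖ ≤ a) (ha0 : 0 ≤ a) (hb : ∀ x, ‖f x‖ ≤ b) :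
    ‖cint (ν : ComplexMeasure X) f‖ ≤
      a * ‖ν‖ + b * (ν : ComplexMeasure X).variation.real Kᶜ := by
  have hKm : MeasurableSet Kᶜ := hK.measurableSet.compl
  refine (norm_cint_le_integral _ _).trans ?_
  calc ∫ x, ‖f x‖ ∂(ν : ComplexMeasure X).variation
      ≤ ∫ x, (a + Kᶜ.indicator (fun _ => b) x) ∂(ν : ComplexMeasure X).variation := by
        refine integral_mono_of_nonneg (.of_forall fun _ => norm_nonneg _)
          ((integrable_const _).add ((integrable_const _).indicator hKm)) (.of_forall fun x => ?_)
        by_cases hx : x ∈ K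
        · simpa [hx] using ha x hx
        · simpa [hx] using (hb x).trans (le_add_of_nonneg_left ha0)
    _ = _ := by
        rw [integral_add (integrable_const _) ((integrable_const _).indicator hKm),
          integral_indicator_const _ hKm, integral_const]
        simp only [smul_eq_mul]
        rw [norm_def, mul_comm, mul_comm b]
        rfl

/-- `Y` need not be first countable, so sequential dominated convergence is not enough. Instead
`|ν|` is nearly carried by a compact `K`, and `F` is continuous in `y` uniformly over `K`. -/
theorem continuous_cint (ν : M X) {F : X → Y → ℂ} (hF : IsBC (Function.uncurry F)) :
    Continuous fun y => cint (ν : ComplexMeasure X) fun x => F x y := by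
  obtain ⟨hc, C, hC⟩ := hF
  have hFx : ∀ y, IsBC fun x => F x y := fun y =>
    ⟨hc.comp (by fun_prop : Continuous fun x => (x, y)), C, fun x => hC (x, y)⟩
  refine continuous_iff_continuousAt.2 fun y₀ => Metric.tendsto_nhds.2 fun δ hδ => ?_
  have hden : 0 < ‖ν‖ + 2 * |C| + 1 := by positivity
  set ε := δ / 2 / (‖ν‖ + 2 * |C| + 1) with hε
  have hε0 : 0 < ε := by positivity
  obtain ⟨K, hK, hKε⟩ := exists_isCompact_compl_le (ν : ComplexMeasure X).variation hε0
  have hev : ∀ᶠ y in nhds y₀, ∀ x ∈ K, ‖F x y - F x y₀‖ < ε := by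
    refine hK.eventually_forall_of_forall_eventually fun x _ => ?_
    have h1 : Continuous fun p : Y × X => ‖F p.2 p.1 - F p.2 y₀‖ :=
      ((hc.comp (by fun_prop : Continuous fun p : Y × X => (p.2, p.1))).sub
        (hc.comp (by fun_prop : Continuous fun p : Y × X => (p.2, y₀)))).norm
    refine h1.continuousAt.eventually_lt continuousAt_const ?_
    simpa using hε0
  filter_upwards [hev] with y hy
  rw [dist_eq_norm, ← cint_sub ((hFx y).integrable _) ((hFx y₀).integrable _)]
  have hb : ∀ x, ‖F x y - F x y₀‖ ≤ 2 * |C| := fun x => by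
    refine (norm_sub_le _ _).trans ?_
    have h1 := (hC (x, y)).trans (le_abs_self C)
    have h2 := (hC (x, y₀)).trans (le_abs_self C)
    simp only [Function.uncurry] at h1 h2
    linarith
  refine (norm_cint_le_of_isCompact ν hK (fun x hx => (hy x hx).le) hε0.le hb).trans_lt ?_
  calc ε * ‖ν‖ + 2 * |C| * (ν : ComplexMeasure X).variation.real Kᶜ
      ≤ ε * ‖ν‖ + 2 * |C| * ε := by gcongr
    _ ≤ ε * (‖ν‖ + 2 * |C| + 1) := by nlinarith
    _ = δ / 2 := by rw [hε]; field_simp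
    _ < δ := by linarith

theorem isBC_cint (ν : M X) {F : X → Y → ℂ} (hF : IsBC (Function.uncurry F)) :
    IsBC fun y => cint (ν : ComplexMeasure X) fun x => F x y := by
  refine ⟨continuous_cint ν hF, ?_⟩
  obtain ⟨-, C, hC⟩ := hF
  exact ⟨C * ‖ν‖, fun y => norm_cint_le_norm ν fun x => hC (x, y)⟩

variable [MeasurableSpace Y] [T2Space Y] [BorelSpace Y]

/-- `F` need not be measurable for the product σ-algebra, so the usual Fubini theorem does not
apply. Bilinearity reduces to positive measures, where compact support suffices. -/
theorem cint_cint_swap_of_hasCompactSupport (ν : M X) (ν' : M Y) {F : X → Y → ℂ}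
    (hF : IsBC (Function.uncurry F)) (hs : HasCompactSupport (Function.uncurry F)) :
    cint (ν' : ComplexMeasure Y) (fun y => cint (ν : ComplexMeasure X) fun x => F x y) =
      cint (ν : ComplexMeasure X) fun x => cint (ν' : ComplexMeasure Y) (F x) := by
  induction ν using M.induction with
  | hadd a b ha hb =>
    have h1 : ∀ y, cint ((a + b : M X) : ComplexMeasure X) (fun x => F x y) =
        cint (a : ComplexMeasure X) (fun x => F x y) +
          cint (b : ComplexMeasure X) (fun x => F x y) := fun y =>
      cint_add_measure_of_isBC (hF.left y)
    simp only [h1]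
    rw [cint_add ((isBC_cint a hF).integrable _) ((isBC_cint b hF).integrable _),
      cint_add_measure_of_isBC (isBC_cint ν' hF.flip), ha, hb]
  | hsmul c a ha =>
    have h1 : ∀ y, cint ((c • a : M X) : ComplexMeasure X) (fun x => F x y) =
        c * cint (a : ComplexMeasure X) (fun x => F x y) := fun y =>
      cint_smul_measure_of_isBC c (hF.left y)
    simp only [h1]
    rw [cint_const_mul, cint_smul_measure_of_isBC c (isBC_cint ν' hF.flip), ha]
  | hpos μ =>
    induction ν' using M.induction with
    | hadd a b ha hb =>
      have h1 : ∀ x, cint ((a + b : M Y) : ComplexMeasure Y) (F x) =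
          cint (a : ComplexMeasure Y) (F x) + cint (b : ComplexMeasure Y) (F x) := fun x =>
        cint_add_measure_of_isBC (hF.right x)
      simp only [h1]
      rw [cint_add ((isBC_cint a hF.flip).integrable _) ((isBC_cint b hF.flip).integrable _),
        cint_add_measure_of_isBC (isBC_cint _ hF), ha, hb]
    | hsmul c a ha =>
      have h1 : ∀ x, cint ((c • a : M Y) : ComplexMeasure Y) (F x) =
          c * cint (a : ComplexMeasure Y) (F x) := fun x =>
        cint_smul_measure_of_isBC c (hF.right x)
      simp only [h1]
      rw [cint_const_mul, cint_smul_measure_of_isBC c (isBC_cint _ hF), ha]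
    | hpos μ' =>
      simp only [cint_ofMeasure]
      exact (integral_integral_swap_of_hasCompactSupport hF.1 hs).symm

theorem norm_one_sub_ofReal_le {r : ℝ} (h0 : 0 ≤ r) (h1 : r ≤ 1) : ‖(1 : ℂ) - r‖ ≤ 1 := by
  rw [← Complex.ofReal_one, ← Complex.ofReal_sub, Complex.norm_real,
    Real.norm_of_nonneg (by linarith)]
  linarith

/-- For `y ∈ L` the error vanishes on `K`, so the inner integral is at most `C * ε`; for other `y`
it is at most `C * ‖ν‖`, and those `y` have mass at most `ε`. -/
theorem norm_cint_cint_sub_cutoff_le (ν : M X) (ν' : M Y) {F : X → Y → ℂ}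
    (hF : IsBC (Function.uncurry F)) {C : ℝ} (hC : ∀ x y, ‖F x y‖ ≤ C) (hC0 : 0 ≤ C)
    {K : Set X} (hK : IsCompact K) {L : Set Y} (hL : IsCompact L) {φ : X → ℝ} {χ : Y → ℝ}
    (hφc : Continuous φ) (hχc : Continuous χ) (hφ1 : ∀ x ∈ K, φ x = 1) (hχ1 : ∀ y ∈ L, χ y = 1)
    (hφ : ∀ x, 0 ≤ φ x ∧ φ x ≤ 1) (hχ : ∀ y, 0 ≤ χ y ∧ χ y ≤ 1) {ε : ℝ}
    (hKε : (ν : ComplexMeasure X).variation.real Kᶜ ≤ ε)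
    (hLε : (ν' : ComplexMeasure Y).variation.real Lᶜ ≤ ε) :
    ‖cint (ν' : ComplexMeasure Y) (fun y => cint (ν : ComplexMeasure X) fun x => F x y) -
      cint (ν' : ComplexMeasure Y) (fun y => cint (ν : ComplexMeasure X) fun x =>
        ((φ x * χ y : ℝ) : ℂ) * F x y)‖ ≤ C * (‖ν‖ + ‖ν'‖) * ε := by
  have hcut : IsBC (Function.uncurry fun x y => ((φ x * χ y : ℝ) : ℂ)) := by
    refine ⟨by unfold Function.uncurry; fun_prop, 1, fun p => ?_⟩
    rw [Function.uncurry, Complex.norm_real,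
      Real.norm_of_nonneg (mul_nonneg (hφ _).1 (hχ _).1)]
    exact mul_le_one₀ (hφ _).2 (hχ _).1 (hχ _).2
  have hF' : IsBC (Function.uncurry fun x y => ((φ x * χ y : ℝ) : ℂ) * F x y) := hcut.mul hF
  have hε0 : 0 ≤ ε := measureReal_nonneg.trans hKε
  rw [← cint_sub ((isBC_cint ν hF).integrable _) ((isBC_cint ν hF').integrable _)]
  have e : ∀ y, cint (ν : ComplexMeasure X) (fun x => F x y) -
      cint (ν : ComplexMeasure X) (fun x => ((φ x * χ y : ℝ) : ℂ) * F x y) =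
      cint (ν : ComplexMeasure X) (fun x => (1 - ((φ x * χ y : ℝ) : ℂ)) * F x y) := by
    intro y
    rw [← cint_sub ((hF.left y).integrable _) ((hF'.left y).integrable _)]
    congr 1 with x
    ring
  simp only [e]
  have hb : ∀ x y, ‖(1 - ((φ x * χ y : ℝ) : ℂ)) * F x y‖ ≤ C := fun x y => by
    rw [norm_mul]
    have h1 := norm_one_sub_ofReal_le (mul_nonneg (hφ x).1 (hχ y).1)
      (mul_le_one₀ (hφ x).2 (hχ y).1 (hχ y).2)
    exact (mul_le_mul h1 (hC x y) (norm_nonneg _) zero_le_one).trans (by simp)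
  have h2 : ∀ y ∈ L, ‖cint (ν : ComplexMeasure X)
      (fun x => (1 - ((φ x * χ y : ℝ) : ℂ)) * F x y)‖ ≤ C * ε := by
    intro y hy
    have := norm_cint_le_of_isCompact ν hK (a := 0)
      (f := fun x => (1 - ((φ x * χ y : ℝ) : ℂ)) * F x y)
      (fun x hx => by simp [hφ1 x hx, hχ1 y hy]) le_rfl (fun x => hb x y)
    refine this.trans ?_
    rw [zero_mul, zero_add]
    gcongr
  have h3 := norm_cint_le_of_isCompact ν' hL h2 (by positivity)
    fun y => norm_cint_le_norm ν fun x => hb x y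
  refine h3.trans ?_
  have : C * ‖ν‖ * (ν' : ComplexMeasure Y).variation.real Lᶜ ≤ C * ‖ν‖ * ε := by gcongr
  linarith

/-- Fubini's theorem for regular complex measures and bounded continuous functions. -/
theorem cint_cint_swap [LocallyCompactSpace X] [LocallyCompactSpace Y] (ν : M X) (ν' : M Y)
    {F : X → Y → ℂ} (hF : IsBC (Function.uncurry F)) :
    cint (ν' : ComplexMeasure Y) (fun y => cint (ν : ComplexMeasure X) fun x => F x y) =
      cint (ν : ComplexMeasure X) fun x => cint (ν' : ComplexMeasure Y) (F x) := by
  obtain ⟨C, hC0, hC⟩ : ∃ C : ℝ, 0 ≤ C ∧ ∀ x y, ‖F x y‖ ≤ C := by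
    obtain ⟨-, C, hC⟩ := hF
    exact ⟨|C|, abs_nonneg _, fun x y => (hC (x, y)).trans (le_abs_self _)⟩
  have hD : 0 < 2 * (C * (‖ν‖ + ‖ν'‖)) + 1 := by positivity
  rw [← sub_eq_zero, ← norm_le_zero_iff]
  refine le_of_forall_pos_le_add fun δ hδ => ?_
  set ε := δ / (2 * (C * (‖ν‖ + ‖ν'‖)) + 1) with hε
  have hε0 : 0 < ε := by positivity
  obtain ⟨K, hK, hKε⟩ := exists_isCompact_compl_le (ν : ComplexMeasure X).variation hε0
  obtain ⟨L, hL, hLε⟩ := exists_isCompact_compl_le (ν' : ComplexMeasure Y).variation hε0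
  obtain ⟨φ, hφc, hφs, hφ1, hφ⟩ := exists_cutoff hK
  obtain ⟨χ, hχc, hχs, hχ1, hχ⟩ := exists_cutoff hL
  -- The cutoff is inserted in both orders of integration; the truncated integrals agree by the
  -- compactly supported case.
  have h1 := norm_cint_cint_sub_cutoff_le ν ν' hF hC hC0 hK hL hφc hχc hφ1 hχ1 hφ hχ hKε hLε
  have h2 := norm_cint_cint_sub_cutoff_le ν' ν hF.flip (fun y x => hC x y) hC0 hL hK hχc hφc hχ1
    hφ1 hχ hφ hLε hKε
  have hs : HasCompactSupport (Function.uncurry fun x y => ((φ x * χ y : ℝ) : ℂ) * F x y) := by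
    refine HasCompactSupport.intro (hφs.isCompact.prod hχs.isCompact) fun p hp => ?_
    rw [Set.mem_prod, not_and_or] at hp
    rcases hp with hp | hp
    · simp [Function.uncurry, image_eq_zero_of_notMem_tsupport hp]
    · simp [Function.uncurry, image_eq_zero_of_notMem_tsupport hp]
  have hcut : IsBC (Function.uncurry fun x y => ((φ x * χ y : ℝ) : ℂ)) := by
    refine ⟨by unfold Function.uncurry; fun_prop, 1, fun p => ?_⟩
    rw [Function.uncurry, Complex.norm_real,
      Real.norm_of_nonneg (mul_nonneg (hφ _).1 (hχ _).1)]
    exact mul_le_one₀ (hφ _).2 (hχ _).1 (hχ _).2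
  have hF' : IsBC (Function.uncurry fun x y => ((φ x * χ y : ℝ) : ℂ) * F x y) := hcut.mul hF
  have h3 := cint_cint_swap_of_hasCompactSupport ν ν' hF' hs
  simp only [mul_comm (χ _)] at h2
  rw [h3] at h1
  rw [zero_add]
  set A := cint (ν' : ComplexMeasure Y) (fun y => cint (ν : ComplexMeasure X) fun x => F x y)
  set B := cint (ν : ComplexMeasure X) fun x => cint (ν' : ComplexMeasure Y) (F x)
  calc ‖A - B‖ ≤ C * (‖ν‖ + ‖ν'‖) * ε + C * (‖ν'‖ + ‖ν‖) * ε := by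
        refine (norm_sub_le_norm_sub_add_norm_sub A _ B).trans (add_le_add h1 ?_)
        rw [norm_sub_rev]
        exact h2
    _ ≤ (2 * (C * (‖ν‖ + ‖ν'‖)) + 1) * ε := by nlinarith
    _ = δ := by rw [hε]; field_simp

end Parametric

/-! ### Vanishing at infinity through compact sets -/

section Vanishing

variable {X : Type*} [TopologicalSpace X]

/-- A function vanishes at infinity if it is small outside of a compact set. -/
def Vanishes (f : X → ℂ) : Prop := ∀ ε > 0, ∃ K : Set X, IsCompact K ∧ ∀ x ∉ K, ‖f x‖ ≤ ε

theorem vanishes_zeroAtInfty (ψ : C₀(X, ℂ)) : Vanishes ψ := by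
  intro ε hε
  have h := (ZeroAtInftyContinuousMapClass.zero_at_infty ψ).norm
  rw [norm_zero] at h
  obtain ⟨K, hK, hKs⟩ := Filter.mem_cocompact.1 (h.eventually (eventually_le_nhds hε))
  exact ⟨K, hK, fun x hx => hKs hx⟩

theorem Vanishes.exists_zeroAtInfty {f : X → ℂ} (hf : Vanishes f) (hc : Continuous f) :
    ∃ φ : C₀(X, ℂ), ∀ x, φ x = f x := by
  refine ⟨⟨⟨f, hc⟩, ?_⟩, fun _ => rfl⟩
  refine Metric.tendsto_nhds.2 fun ε hε => ?_
  obtain ⟨K, hK, h⟩ := hf (ε / 2) (by positivity)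
  filter_upwards [hK.compl_mem_cocompact] with x hx
  rw [dist_zero_right]
  exact (h x hx).trans_lt (by linarith)

end Vanishing

/-! ### Riesz representation of bounded positive functionals on `C₀` -/

section Riesz

open CompactlySupported

variable {X : Type*} [TopologicalSpace X]

/-- A compactly supported continuous real function as a complex function vanishing at infinity. -/
def ofCompactlySupported (f : C_c(X, ℝ)) : C₀(X, ℂ) :=
  ⟨⟨fun x => (f x : ℂ), Complex.continuous_ofReal.comp f.continuous⟩,
    (f.hasCompactSupport.comp_left (g := fun r : ℝ => (r : ℂ)) (by simp)).is_zero_at_infty⟩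

theorem ofCompactlySupported_apply (f : C_c(X, ℝ)) (x : X) :
    ofCompactlySupported f x = (f x : ℂ) := rfl

variable [T2Space X]

theorem exists_hasCompactSupport_norm_sub_le [LocallyCompactSpace X] (ψ : C₀(X, ℂ)) {ε : ℝ}
    (hε : 0 < ε) : ∃ ψ' : C₀(X, ℂ), HasCompactSupport ψ' ∧ ‖ψ - ψ'‖ ≤ ε := by
  obtain ⟨K, hK, hKε⟩ := vanishes_zeroAtInfty ψ ε hε
  obtain ⟨φ, hφc, hφs, hφ1, hφ⟩ := exists_cutoff hK
  have hs : HasCompactSupport fun x => (φ x : ℂ) * ψ x :=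
    HasCompactSupport.mul_right (hφs.comp_left (g := fun r : ℝ => (r : ℂ)) (by simp))
  have hc : Continuous fun x => (φ x : ℂ) * ψ x :=
    (Complex.continuous_ofReal.comp hφc).mul (map_continuous ψ)
  refine ⟨⟨⟨_, hc⟩, hs.is_zero_at_infty⟩, hs, norm_zeroAtInfty_le hε.le fun x => ?_⟩
  change ‖ψ x - (φ x : ℂ) * ψ x‖ ≤ ε
  rw [← one_sub_mul, norm_mul]
  by_cases hx : x ∈ K
  · simpa [hφ1 x hx] using hε.le
  · calc ‖(1 : ℂ) - φ x‖ * ‖ψ x‖ ≤ 1 * ε := by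
          gcongr
          · exact norm_one_sub_ofReal_le (hφ x).1 (hφ x).2
          · exact hKε x hx
      _ = ε := one_mul ε

variable [LocallyCompactSpace X] [MeasurableSpace X] [BorelSpace X]

/-- A bounded positive functional on `C₀(X)` is given by a regular measure. -/
theorem exists_cint_eq_of_nonneg (Λ : C₀(X, ℂ) →ₗ[ℂ] ℂ) {C : ℝ} (hC : ∀ ψ, ‖Λ ψ‖ ≤ C * ‖ψ‖)
    (hpos : ∀ ψ : C₀(X, ℂ), (∀ x, ∃ r : ℝ, 0 ≤ r ∧ ψ x = r) → ∃ r : ℝ, 0 ≤ r ∧ Λ ψ = r) :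
    ∃ κ : M X, ∀ ψ : C₀(X, ℂ), cint (κ : ComplexMeasure X) ψ = Λ ψ := by
  have hι : ∀ f : C_c(X, ℝ), 0 ≤ f → ∃ r : ℝ, 0 ≤ r ∧ Λ (ofCompactlySupported f) = r :=
    fun f hf => hpos _ fun x => ⟨f x, hf x, rfl⟩
  let Λr : C_c(X, ℝ) →ₚ[ℝ] ℝ := PositiveLinearMap.mk₀
    { toFun := fun f => (Λ (ofCompactlySupported f)).re
      map_add' := fun f g => by
        rw [← Complex.add_re, ← map_add]
        congr 2
        ext x
        simp [ofCompactlySupported_apply]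
      map_smul' := fun c f => by
        have : ofCompactlySupported (c • f) = (c : ℂ) • ofCompactlySupported f := by
          ext x
          simp [ofCompactlySupported_apply]
        rw [this, map_smul]
        simp }
    (fun f hf => by
      obtain ⟨r, hr, h⟩ := hι f hf
      change 0 ≤ (Λ (ofCompactlySupported f)).re
      rw [h]
      simpa using hr)
  have hΛr : ∀ f, Λr f = (Λ (ofCompactlySupported f)).re := fun f => rfl
  -- Positivity forces real values: `f = (f + |f|) - |f|` is a difference of nonnegative functions.
  have hreal : ∀ f, Λ (ofCompactlySupported f) = (Λr f : ℂ) := by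
    intro f
    obtain ⟨r, -, hr⟩ := hι |f| (abs_nonneg f)
    obtain ⟨s, -, hs⟩ := hι (f + |f|) (neg_le_iff_add_nonneg'.1 (neg_le_abs f))
    have e : ofCompactlySupported f = ofCompactlySupported (f + |f|) - ofCompactlySupported |f| := by
      ext x
      simp [ofCompactlySupported_apply]
    rw [hΛr, e, map_sub, hr, hs]
    simp
  set μ := RealRMK.rieszMeasure Λr with hμ
  -- A cutoff bounds the mass of every compact set by the bound of `Λ`; inner regularity passes this
  -- to the whole space. The sign of `C` is not assumed, hence `max C 0`.
  have hfin : IsFiniteMeasure μ := by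
    refine ⟨lt_of_le_of_lt (b := ENNReal.ofReal (max C 0)) ?_ ENNReal.ofReal_lt_top⟩
    rw [isOpen_univ.measure_eq_iSup_isCompact]
    refine iSup_le fun K => iSup_le fun _ => iSup_le fun hK => ?_
    obtain ⟨φ, hφc, hφs, hφ1, hφ⟩ := exists_cutoff hK
    let f : C_c(X, ℝ) := ⟨⟨φ, hφc⟩, hφs⟩
    refine (RealRMK.rieszMeasure_le_of_eq_one Λr (f := f) (fun x => (hφ x).1) hK hφ1).trans ?_
    refine ENNReal.ofReal_le_ofReal ?_
    have hn : ‖ofCompactlySupported f‖ ≤ 1 := norm_zeroAtInfty_le zero_le_one fun x => by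
      rw [ofCompactlySupported_apply, Complex.norm_real]
      exact (Real.norm_of_nonneg (hφ x).1).trans_le (hφ x).2
    calc Λr f ≤ ‖Λ (ofCompactlySupported f)‖ := Complex.re_le_norm _
      _ ≤ C * ‖ofCompactlySupported f‖ := hC _
      _ ≤ max C 0 * ‖ofCompactlySupported f‖ := by gcongr; exact le_max_left _ _
      _ ≤ max C 0 := mul_le_of_le_one_right (le_max_right _ _) hn
  have hcs : ∀ ψ : C₀(X, ℂ), HasCompactSupport ψ → ∫ x, ψ x ∂μ = Λ ψ := by
    intro ψ hψ
    let f : C_c(X, ℝ) := ⟨⟨fun x => (ψ x).re, Complex.continuous_re.comp (map_continuous ψ)⟩,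
      hψ.comp_left (g := Complex.re) rfl⟩
    let g : C_c(X, ℝ) := ⟨⟨fun x => (ψ x).im, Complex.continuous_im.comp (map_continuous ψ)⟩,
      hψ.comp_left (g := Complex.im) rfl⟩
    have e : ψ = ofCompactlySupported f + Complex.I • ofCompactlySupported g := by
      ext x
      rw [ZeroAtInftyContinuousMap.add_apply, ZeroAtInftyContinuousMap.smul_apply, smul_eq_mul,
        mul_comm]
      exact (Complex.re_add_im _).symm
    have e1 : Λ ψ = (Λr f : ℂ) + Complex.I * (Λr g : ℂ) := by
      rw [e, map_add, map_smul, hreal, hreal, smul_eq_mul]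
    have hi : Integrable ψ μ := (IsBC.zeroAtInfty ψ).integrable μ
    rw [e1, ← RealRMK.integral_rieszMeasure Λr f, ← RealRMK.integral_rieszMeasure Λr g,
      ← integral_re_add_im hi, mul_comm]
    rfl
  refine ⟨ofMeasure μ, fun ψ => ?_⟩
  rw [cint_ofMeasure, ← sub_eq_zero, ← norm_le_zero_iff]
  refine le_of_forall_pos_le_add fun δ hδ => ?_
  -- Both functionals are continuous in the sup norm, so agreement on compactly supported functions
  -- extends to `C₀`.
  have hD : 0 < |C| + μ.real Set.univ + 1 := by positivity
  obtain ⟨ψ', hψ's, hψ'⟩ := exists_hasCompactSupport_norm_sub_le ψ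
    (ε := δ / (|C| + μ.real Set.univ + 1)) (by positivity)
  have hi := fun ψ : C₀(X, ℂ) => (IsBC.zeroAtInfty ψ).integrable μ
  have e : ∫ x, ψ x ∂μ - Λ ψ = ∫ x, (ψ - ψ') x ∂μ - Λ (ψ - ψ') := by
    rw [map_sub, ← hcs ψ' hψ's]
    have : ∫ x, (ψ - ψ') x ∂μ = ∫ x, ψ x ∂μ - ∫ x, ψ' x ∂μ := integral_sub (hi ψ) (hi ψ')
    rw [this]
    ring
  have h1 : ‖∫ x, (ψ - ψ') x ∂μ‖ ≤ ‖ψ - ψ'‖ * μ.real Set.univ :=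
    norm_integral_le_of_norm_le_const (.of_forall (norm_apply_le_norm_zeroAtInfty _))
  have h2 : ‖Λ (ψ - ψ')‖ ≤ |C| * ‖ψ - ψ'‖ := (hC _).trans (by gcongr; exact le_abs_self C)
  rw [e, zero_add]
  calc ‖∫ x, (ψ - ψ') x ∂μ - Λ (ψ - ψ')‖
      ≤ ‖ψ - ψ'‖ * (|C| + μ.real Set.univ + 1) := by
        refine (norm_sub_le _ _).trans ?_
        nlinarith [norm_nonneg (ψ - ψ')]
    _ ≤ δ / (|C| + μ.real Set.univ + 1) * (|C| + μ.real Set.univ + 1) := by gcongr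
    _ = δ := by field_simp

end Riesz

/-! ### Bi-invariance of Haar measure on a compact group -/

section Haar

variable {K : Type*} [Group K] [TopologicalSpace K] [IsTopologicalGroup K] [CompactSpace K]
  [MeasurableSpace K] [BorelSpace K]

instance isProbabilityMeasure_haar :
    IsProbabilityMeasure (Measure.haarMeasure (⊤ : TopologicalSpace.PositiveCompacts K)) :=
  ⟨Measure.haarMeasure_self⟩

/-- A left invariant probability measure on a compact group is the Haar measure. -/
theorem eq_haarMeasure_of_isMulLeftInvariant (μ : Measure K) [IsProbabilityMeasure μ]
    [μ.IsMulLeftInvariant] : μ = Measure.haarMeasure ⊤ := by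
  have h := Measure.isMulInvariant_eq_smul_of_compactSpace μ
    (Measure.haarMeasure (⊤ : TopologicalSpace.PositiveCompacts K))
  have h1 := congrArg (fun m : Measure K => m Set.univ) h
  simp only [measure_univ, Measure.smul_apply, ENNReal.smul_def, smul_eq_mul, mul_one] at h1
  have h2 : Measure.haarScalarFactor μ (Measure.haarMeasure
    (⊤ : TopologicalSpace.PositiveCompacts K)) = 1 := by exact_mod_cast h1.symm
  rw [h, h2, one_smul]

/-- A right translate of Haar measure is again a left-invariant probability measure, so uniqueness
applies. -/
instance isMulRightInvariant_haar :
    (Measure.haarMeasure (⊤ : TopologicalSpace.PositiveCompacts K)).IsMulRightInvariant := by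
  refine ⟨fun k => ?_⟩
  have : IsProbabilityMeasure (Measure.map (· * k)
      (Measure.haarMeasure (⊤ : TopologicalSpace.PositiveCompacts K))) :=
    Measure.isProbabilityMeasure_map (by fun_prop)
  exact eq_haarMeasure_of_isMulLeftInvariant _

/-- Inversion turns right invariance into left invariance, and uniqueness applies again. -/
instance isInvInvariant_haar :
    (Measure.haarMeasure (⊤ : TopologicalSpace.PositiveCompacts K)).IsInvInvariant := by
  refine ⟨?_⟩
  have : IsProbabilityMeasure (Measure.haarMeasure
      (⊤ : TopologicalSpace.PositiveCompacts K)).inv :=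
    Measure.isProbabilityMeasure_map (by fun_prop)
  exact eq_haarMeasure_of_isMulLeftInvariant _

variable (K) in
/-- The normalized Haar measure of a compact Hausdorff group as a regular complex measure. -/
def haarM [T2Space K] : M K := ofMeasure (Measure.haarMeasure ⊤)

theorem cint_haarM [T2Space K] (f : K → ℂ) :
    cint (haarM K : ComplexMeasure K) f = ∫ h, f h ∂(Measure.haarMeasure ⊤) :=
  cint_ofMeasure _ f

end Haar

/-! ### The kernels on the coset space and their decay -/

section Quotient

variable {G : Type*} [Group G] [TopologicalSpace G] [IsTopologicalGroup G]
  {H : Subgroup G}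

theorem continuous_mk_inv : Continuous fun g : G => ((g⁻¹ : G) : G ⧸ H) :=
  QuotientGroup.continuous_mk.comp continuous_inv

variable [CompactSpace H]

/-- The projection is proper: it is closed because `H` is compact, and its fibres are translates of
`H`. -/
theorem isCompact_preimage_mk {K : Set (G ⧸ H)} (hK : IsCompact K) :
    IsCompact ((QuotientGroup.mk : G → G ⧸ H) ⁻¹' K) := by
  have hH : IsCompact (H : Set G) := isCompact_iff_compactSpace.mpr ‹_›
  have hp : IsProperMap (QuotientGroup.mk : G → G ⧸ H) := by
    refine isProperMap_iff_isClosedMap_and_compact_fibers.2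
      ⟨QuotientGroup.continuous_mk, QuotientGroup.isClosedMap_coe hH, fun y => ?_⟩
    obtain ⟨g, rfl⟩ := QuotientGroup.mk_surjective y
    have : (QuotientGroup.mk : G → G ⧸ H) ⁻¹' {(g : G ⧸ H)} = (fun h => g * h) '' (H : Set G) := by
      ext x
      simp only [Set.mem_preimage, Set.mem_singleton_iff, Set.mem_image, SetLike.mem_coe]
      rw [eq_comm, QuotientGroup.eq]
      exact ⟨fun h => ⟨g⁻¹ * x, h, by simp⟩, by rintro ⟨h, hh, rfl⟩; simpa using hh⟩
    rw [this]
    exact hH.image (by fun_prop)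
  exact hp.isCompact_preimage hK

variable [MeasurableSpace H] [BorelSpace H]

theorem norm_TH_le {f : G → ℂ} {x : G} {C : ℝ} (hf : ∀ h : H, ‖f (x * h)‖ ≤ C) :
    ‖TH f (x : G ⧸ H)‖ ≤ C := by
  rw [TH_mk]
  refine (norm_integral_le_of_norm_le_const (.of_forall hf)).trans ?_
  simp

theorem norm_TH_le_of_forall {f : G → ℂ} {C : ℝ} (hf : ∀ g, ‖f g‖ ≤ C) (x : G ⧸ H) :
    ‖TH f x‖ ≤ C := by
  obtain ⟨g, rfl⟩ := QuotientGroup.mk_surjective x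
  exact norm_TH_le fun h => hf _

theorem vanishes_TH {f : G → ℂ} (hf : Vanishes f) : Vanishes (TH f : G ⧸ H → ℂ) := by
  intro ε hε
  obtain ⟨K, hK, h⟩ := hf ε hε
  refine ⟨(QuotientGroup.mk : G → G ⧸ H) '' K, hK.image QuotientGroup.continuous_mk,
    fun x hx => ?_⟩
  obtain ⟨g, rfl⟩ := QuotientGroup.mk_surjective x
  refine norm_TH_le fun k => h _ fun hk => hx ⟨g * k, hk, ?_⟩
  exact QuotientGroup.mk_mul_of_mem g k.2

/-- The kernel `(xH, yH) ↦ ∫_H f(xhyH) dh` of the convolution. -/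
def convKernel (f : G ⧸ H → ℂ) (x y : G ⧸ H) : ℂ := TH (fun g : G => f (g • y)) x

/-- The function `xH ↦ ∫_H f(h⁻¹x⁻¹H) dh`. -/
def involKernel (f : G ⧸ H → ℂ) (x : G ⧸ H) : ℂ := TH (fun g : G => f ((g⁻¹ : G) : G ⧸ H)) x

theorem norm_convKernel_le (ψ : C₀(G ⧸ H, ℂ)) (x y : G ⧸ H) : ‖convKernel ψ x y‖ ≤ ‖ψ‖ :=
  norm_TH_le_of_forall (fun _ => norm_apply_le_norm_zeroAtInfty ψ _) x

theorem norm_involKernel_le (ψ : C₀(G ⧸ H, ℂ)) (x : G ⧸ H) : ‖involKernel ψ x‖ ≤ ‖ψ‖ :=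
  norm_TH_le_of_forall (fun _ => norm_apply_le_norm_zeroAtInfty ψ _) x

variable [T2Space G]

theorem TH_eq_cint (f : G → ℂ) (x : G) :
    TH f (x : G ⧸ H) = cint (haarM H : ComplexMeasure H) fun h => f (x * h) := by
  rw [TH_mk, cint_haarM]

/-- The projection is open, so its product with the identity of `Y` is still a quotient map.
Continuity can be checked upstairs, where this is a parameter integral over `H`. -/
theorem isBC_uncurry_TH {Y : Type*} [TopologicalSpace Y] {F : G → Y → ℂ}
    (hF : IsBC (Function.uncurry F)) :
    IsBC (Function.uncurry fun (x : G ⧸ H) y => TH (fun g => F g y) x) := by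
  refine ⟨?_, ?_⟩
  · have hq : IsOpenQuotientMap
        (Prod.map (QuotientGroup.mk : G → G ⧸ H) (id : Y → Y)) :=
      QuotientGroup.isOpenQuotientMap_mk.prodMap IsOpenQuotientMap.id
    rw [← hq.continuous_comp_iff]
    have : Continuous fun p : G × Y =>
        cint (haarM H : ComplexMeasure H) fun h => F (p.1 * h) p.2 := by
      refine continuous_cint (haarM H) (F := fun (h : H) (p : G × Y) => F (p.1 * h) p.2) ?_
      exact hF.comp (by fun_prop : Continuous fun q : H × (G × Y) => (q.2.1 * (q.1 : G), q.2.2))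
    refine this.congr fun p => ?_
    exact (TH_eq_cint (fun g => F g p.2) p.1).symm
  · obtain ⟨-, C, hC⟩ := hF
    exact ⟨C, fun p => norm_TH_le_of_forall (fun g => hC (g, p.2)) p.1⟩

theorem isBC_TH {f : G → ℂ} (hf : IsBC f) : IsBC (TH f : G ⧸ H → ℂ) := by
  have h : IsBC (Function.uncurry fun (g : G) (_ : Unit) => f g) :=
    hf.comp (by fun_prop : Continuous fun p : G × Unit => p.1)
  exact (isBC_uncurry_TH (H := H) h).comp (by fun_prop : Continuous fun x : G ⧸ H => (x, ()))

theorem convKernel_mk (f : G ⧸ H → ℂ) (x : G) (y : G ⧸ H) :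
    convKernel f x y = cint (haarM H : ComplexMeasure H) fun h => f ((x * h) • y) :=
  TH_eq_cint _ _

theorem involKernel_mk (f : G ⧸ H → ℂ) (x : G) :
    involKernel f (x : G ⧸ H) =
      cint (haarM H : ComplexMeasure H) fun h => f (((x * h)⁻¹ : G) : G ⧸ H) :=
  TH_eq_cint _ _

theorem isBC_convKernel {f : G ⧸ H → ℂ} (hf : IsBC f) :
    IsBC (Function.uncurry (convKernel f)) := by
  have : IsBC (Function.uncurry fun (g : G) (y : G ⧸ H) => f (g • y)) :=
    hf.comp (by fun_prop : Continuous fun p : G × (G ⧸ H) => p.1 • p.2)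
  exact isBC_uncurry_TH this

theorem isBC_uncurry_involKernel {Y : Type*} [TopologicalSpace Y] {F : G ⧸ H → Y → ℂ}
    (hF : IsBC (Function.uncurry F)) :
    IsBC (Function.uncurry fun x y => involKernel (fun z => F z y) x) := by
  have : IsBC (Function.uncurry fun (g : G) y => F ((g⁻¹ : G) : G ⧸ H) y) :=
    hF.comp (g := fun p : G × Y => (((p.1⁻¹ : G) : G ⧸ H), p.2))
      ((continuous_mk_inv.comp continuous_fst).prodMk continuous_snd)
  exact isBC_uncurry_TH this

theorem isBC_involKernel {f : G ⧸ H → ℂ} (hf : IsBC f) : IsBC (involKernel f) := by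
  have h : IsBC fun g : G => f ((g⁻¹ : G) : G ⧸ H) := hf.comp continuous_mk_inv
  exact isBC_TH h

/-- Lets a convolution be integrated against the kernel with its second variable fixed. For `y =
zH`, smallness holds off a right translate by `z⁻¹` of a compact preimage. -/
theorem exists_eq_convKernel_left (ψ : C₀(G ⧸ H, ℂ)) (y : G ⧸ H) :
    ∃ φ : C₀(G ⧸ H, ℂ), ∀ x, φ x = convKernel ψ x y := by
  refine Vanishes.exists_zeroAtInfty (vanishes_TH ?_) ((isBC_convKernel (.zeroAtInfty ψ)).left y).1
  intro ε hε
  obtain ⟨K, hK, h⟩ := vanishes_zeroAtInfty ψ ε hε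
  obtain ⟨z, rfl⟩ := QuotientGroup.mk_surjective y
  refine ⟨(fun g => g * z⁻¹) '' ((QuotientGroup.mk : G → G ⧸ H) ⁻¹' K),
    (isCompact_preimage_mk hK).image (by fun_prop), fun g hg => h _ fun hgK => hg ?_⟩
  exact ⟨g * z, hgK, by simp⟩

theorem exists_eq_involKernel (ψ : C₀(G ⧸ H, ℂ)) :
    ∃ φ : C₀(G ⧸ H, ℂ), ∀ x, φ x = involKernel ψ x := by
  refine Vanishes.exists_zeroAtInfty (vanishes_TH ?_) (isBC_involKernel (.zeroAtInfty ψ)).1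
  intro ε hε
  obtain ⟨K, hK, h⟩ := vanishes_zeroAtInfty ψ ε hε
  refine ⟨(fun g => g⁻¹) '' ((QuotientGroup.mk : G → G ⧸ H) ⁻¹' K),
    (isCompact_preimage_mk hK).image (by fun_prop), fun g hg => h _ fun hgK => hg ?_⟩
  exact ⟨g⁻¹, hgK, by simp⟩

variable [MeasurableSpace (G ⧸ H)] [BorelSpace (G ⧸ H)]

/-- Choose compact `K` outside which `ψ` is small and compact `L` nearly carrying `|lam|`. If `y`
lies outside `g⁻¹K` for every `g` over `L`, the kernel is small for all `x ∈ L`. -/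
theorem exists_eq_cint_convKernel (lam : M (G ⧸ H)) (ψ : C₀(G ⧸ H, ℂ)) :
    ∃ φ : C₀(G ⧸ H, ℂ), ∀ y,
      φ y = cint (lam : ComplexMeasure (G ⧸ H)) fun x => convKernel ψ x y := by
  refine Vanishes.exists_zeroAtInfty ?_ (continuous_cint lam (isBC_convKernel (.zeroAtInfty ψ)))
  intro δ hδ
  set ε := δ / (‖lam‖ + ‖ψ‖ + 1) with hε
  have hε0 : 0 < ε := by positivity
  obtain ⟨K, hK, h⟩ := vanishes_zeroAtInfty ψ ε hε0
  obtain ⟨L, hL, hLε⟩ := exists_isCompact_compl_le (lam : ComplexMeasure (G ⧸ H)).variation hε0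
  refine ⟨(fun p : G × (G ⧸ H) => p.1⁻¹ • p.2) '' (((QuotientGroup.mk : G → G ⧸ H) ⁻¹' L) ×ˢ K),
    ((isCompact_preimage_mk hL).prod hK).image (by fun_prop), fun y hy => ?_⟩
  have hb : ∀ x ∈ L, ‖convKernel ψ x y‖ ≤ ε := by
    intro x hx
    obtain ⟨g, rfl⟩ := QuotientGroup.mk_surjective x
    refine norm_TH_le fun k => h _ fun hk => hy ⟨(g * k, (g * (k : G)) • y), ⟨?_, hk⟩, ?_⟩
    · change ((g * (k : G) : G) : G ⧸ H) ∈ L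
      rwa [QuotientGroup.mk_mul_of_mem g k.2]
    · exact inv_smul_smul _ _
  refine (norm_cint_le_of_isCompact lam hL hb hε0.le
    fun x => norm_convKernel_le ψ x y).trans ?_
  calc ε * ‖lam‖ + ‖ψ‖ * (lam : ComplexMeasure (G ⧸ H)).variation.real Lᶜ
      ≤ ε * ‖lam‖ + ‖ψ‖ * ε := by gcongr
    _ ≤ ε * (‖lam‖ + ‖ψ‖ + 1) := by nlinarith
    _ = δ := by rw [hε]; field_simp

end Quotient

theorem exists_integral_eq_ofReal {X : Type*} [MeasurableSpace X] (μ : Measure X)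
    {f : X → ℂ} (hf : ∀ x, ∃ r : ℝ, 0 ≤ r ∧ f x = r) :
    ∃ r : ℝ, 0 ≤ r ∧ ∫ x, f x ∂μ = r := by
  choose r hr hfr using hf
  exact ⟨∫ x, r x ∂μ, integral_nonneg hr, by simp_rw [hfr]; exact integral_ofReal⟩

/-! ### Conjugation and transport of measures -/

section Conj

variable {X : Type*} [MeasurableSpace X] [TopologicalSpace X] [T2Space X] [BorelSpace X]

/-- Complex conjugation on `M(X)`. -/
def conjM (ν : M X) : M X :=
  ⟨conjMeasure ν, by
    refine regular_of_le_add (μ := (ν : ComplexMeasure X).variation) (ν := 0) ?_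
    rw [add_zero]
    exact variation_conjMeasure_le _⟩

theorem conjM_add (a b : M X) : conjM (a + b) = conjM a + conjM b := by
  ext E _
  exact map_add (starRingEnd ℂ) _ _

theorem conjM_smul (c : ℂ) (a : M X) : conjM (c • a) = conj c • conjM a := by
  ext E _
  exact map_mul (starRingEnd ℂ) _ _

theorem conjM_conjM (a : M X) : conjM (conjM a) = a := by
  ext E _
  exact Complex.conj_conj _

theorem norm_conjM_le (a : M X) : ‖conjM a‖ ≤ ‖a‖ :=
  ENNReal.toReal_mono (measure_ne_top _ _) (variation_conjMeasure_le _ _)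

theorem cint_conjM {a : M X} {f : X → ℂ} (hf : IsBC f) :
    cint (conjM a : ComplexMeasure X) f =
      conj (cint (a : ComplexMeasure X) fun x => conj (f x)) :=
  cint_conjMeasure (hf.integrable _)

/-- The image of a regular complex measure under a homeomorphism. -/
def mapM (e : X ≃ₜ X) (ν : M X) : M X :=
  ⟨(ν : ComplexMeasure X).map e, by
    change (VectorMeasure.map _ _).variation.Regular
    rw [e.measurableEmbedding.variation_map]
    exact Measure.Regular.map e⟩

theorem mapM_apply (e : X ≃ₜ X) (ν : M X) {E : Set X} (hE : MeasurableSet E) :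
    (mapM e ν : ComplexMeasure X) E = (ν : ComplexMeasure X) (e ⁻¹' E) :=
  VectorMeasure.map_apply _ e.continuous.measurable hE

theorem cint_mapM (e : X ≃ₜ X) (ν : M X) (f : X → ℂ) :
    cint (mapM e ν : ComplexMeasure X) f = cint (ν : ComplexMeasure X) fun x => f (e x) :=
  e.measurableEmbedding.integral_map_vectorMeasure

theorem cint_add_of_isBC {ν : M X} {f g : X → ℂ} (hf : IsBC f) (hg : IsBC g) :
    cint (ν : ComplexMeasure X) (fun x => f x + g x) =
      cint (ν : ComplexMeasure X) f + cint (ν : ComplexMeasure X) g :=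
  cint_add (hf.integrable _) (hg.integrable _)

end Conj

/-! ### Linearity, conjugation and positivity of the kernels -/

section Kernel

variable {G : Type*} [Group G] [TopologicalSpace G] [IsTopologicalGroup G]
  {H : Subgroup G}

theorem isBC_translate {f : G ⧸ H → ℂ} (hf : IsBC f) (x y : G) :
    IsBC fun h : H => f ((x * h * y : G) : G ⧸ H) :=
  hf.comp (g := fun h : H => ((x * h * y : G) : G ⧸ H))
    (QuotientGroup.continuous_mk.comp (by fun_prop))

theorem isBC_translate_inv {f : G ⧸ H → ℂ} (hf : IsBC f) (x : G) :
    IsBC fun h : H => f (((x * h)⁻¹ : G) : G ⧸ H) :=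
  hf.comp (g := fun h : H => (((x * h)⁻¹ : G) : G ⧸ H))
    (QuotientGroup.continuous_mk.comp (by fun_prop))

variable [T2Space G] [CompactSpace H] [MeasurableSpace H] [BorelSpace H]

theorem convKernel_add {f g : G ⧸ H → ℂ} (hf : IsBC f) (hg : IsBC g) (x y : G ⧸ H) :
    convKernel (f + g) x y = convKernel f x y + convKernel g x y := by
  obtain ⟨x, rfl⟩ := QuotientGroup.mk_surjective x
  obtain ⟨y, rfl⟩ := QuotientGroup.mk_surjective y
  simp only [convKernel_mk]
  exact cint_add_of_isBC (isBC_translate hf x y) (isBC_translate hg x y)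

theorem convKernel_smul (c : ℂ) (f : G ⧸ H → ℂ) (x y : G ⧸ H) :
    convKernel (c • f) x y = c * convKernel f x y := by
  obtain ⟨x, rfl⟩ := QuotientGroup.mk_surjective x
  simp only [convKernel_mk]
  exact cint_const_mul _ _ _

theorem convKernel_conj (f : G ⧸ H → ℂ) (x y : G ⧸ H) :
    convKernel (fun z => conj (f z)) x y = conj (convKernel f x y) := by
  obtain ⟨x, rfl⟩ := QuotientGroup.mk_surjective x
  simp only [convKernel_mk, cint_haarM]
  exact integral_conj

theorem involKernel_add {f g : G ⧸ H → ℂ} (hf : IsBC f) (hg : IsBC g) (x : G ⧸ H) :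
    involKernel (f + g) x = involKernel f x + involKernel g x := by
  obtain ⟨x, rfl⟩ := QuotientGroup.mk_surjective x
  simp only [involKernel_mk]
  exact cint_add_of_isBC (isBC_translate_inv hf x) (isBC_translate_inv hg x)

theorem involKernel_smul (c : ℂ) (f : G ⧸ H → ℂ) (x : G ⧸ H) :
    involKernel (c • f) x = c * involKernel f x := by
  obtain ⟨x, rfl⟩ := QuotientGroup.mk_surjective x
  simp only [involKernel_mk]
  exact cint_const_mul _ _ _

theorem involKernel_conj (f : G ⧸ H → ℂ) (x : G ⧸ H) :
    involKernel (fun z => conj (f z)) x = conj (involKernel f x) := by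
  obtain ⟨x, rfl⟩ := QuotientGroup.mk_surjective x
  simp only [involKernel_mk, cint_haarM]
  exact integral_conj

theorem exists_convKernel_eq_ofReal {f : G ⧸ H → ℂ} (hf : ∀ x, ∃ r : ℝ, 0 ≤ r ∧ f x = r)
    (x y : G ⧸ H) : ∃ r : ℝ, 0 ≤ r ∧ convKernel f x y = r := by
  obtain ⟨x, rfl⟩ := QuotientGroup.mk_surjective x
  rw [convKernel_mk, cint_haarM]
  exact exists_integral_eq_ofReal _ fun h => hf _

theorem exists_involKernel_eq_ofReal {f : G ⧸ H → ℂ} (hf : ∀ x, ∃ r : ℝ, 0 ≤ r ∧ f x = r)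
    (x : G ⧸ H) : ∃ r : ℝ, 0 ≤ r ∧ involKernel f x = r := by
  obtain ⟨x, rfl⟩ := QuotientGroup.mk_surjective x
  rw [involKernel_mk, cint_haarM]
  exact exists_integral_eq_ofReal _ fun h => hf _

end Kernel

/-! ### Existence and uniqueness of product and involution -/

section Convolution

variable {G : Type*} [Group G] [TopologicalSpace G] [IsTopologicalGroup G] [T2Space G]
  {H : Subgroup G} [CompactSpace H] [MeasurableSpace H] [BorelSpace H]
  [MeasurableSpace (G ⧸ H)] [BorelSpace (G ⧸ H)]

theorem isBC_cint_convKernel (a : M (G ⧸ H)) (ψ : C₀(G ⧸ H, ℂ)) :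
    IsBC fun y => cint (a : ComplexMeasure (G ⧸ H)) fun x => convKernel ψ x y :=
  isBC_cint a (isBC_convKernel (.zeroAtInfty ψ))

theorem norm_cint_cint_convKernel_le (a b : M (G ⧸ H)) (ψ : C₀(G ⧸ H, ℂ)) :
    ‖cint (b : ComplexMeasure (G ⧸ H)) fun y =>
      cint (a : ComplexMeasure (G ⧸ H)) fun x => convKernel ψ x y‖ ≤ ‖a‖ * ‖b‖ * ‖ψ‖ := by
  refine (norm_cint_le_norm b fun y => norm_cint_le_norm a fun x =>
    norm_convKernel_le ψ x y).trans (le_of_eq (by ring))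

/-- Linearity of the relation itself serves twice: it reduces existence to positive measures, and
with uniqueness it makes `conv` bilinear. -/
theorem IsConv.add_left {a a' b κ κ' : M (G ⧸ H)} (h : IsConv a b κ) (h' : IsConv a' b κ') :
    IsConv (a + a') b (κ + κ') := by
  intro ψ
  have h1 : ∀ y, cint ((a + a' : M (G ⧸ H)) : ComplexMeasure (G ⧸ H))
      (fun x => convKernel ψ x y) = cint (a : ComplexMeasure (G ⧸ H)) (fun x => convKernel ψ x y) +
        cint (a' : ComplexMeasure (G ⧸ H)) (fun x => convKernel ψ x y) := fun y =>
    cint_add_measure_of_isBC ((isBC_convKernel (.zeroAtInfty ψ)).left y)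
  change _ = cint (b : ComplexMeasure (G ⧸ H)) fun y => cint _ fun x => convKernel ψ x y
  rw [cint_add_measure_of_isBC (.zeroAtInfty ψ), h, h', funext h1]
  exact (cint_add_of_isBC (isBC_cint_convKernel a ψ) (isBC_cint_convKernel a' ψ)).symm

theorem IsConv.add_right {a b b' κ κ' : M (G ⧸ H)} (h : IsConv a b κ) (h' : IsConv a b' κ') :
    IsConv a (b + b') (κ + κ') := by
  intro ψ
  rw [cint_add_measure_of_isBC (.zeroAtInfty ψ), h, h']
  exact (cint_add_measure_of_isBC (isBC_cint_convKernel a ψ)).symm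

theorem IsConv.smul_left {a b κ : M (G ⧸ H)} (c : ℂ) (h : IsConv a b κ) :
    IsConv (c • a) b (c • κ) := by
  intro ψ
  have h1 : ∀ y, cint ((c • a : M (G ⧸ H)) : ComplexMeasure (G ⧸ H))
      (fun x => convKernel ψ x y) =
        c * cint (a : ComplexMeasure (G ⧸ H)) (fun x => convKernel ψ x y) := fun y =>
    cint_smul_measure_of_isBC c ((isBC_convKernel (.zeroAtInfty ψ)).left y)
  change _ = cint (b : ComplexMeasure (G ⧸ H)) fun y => cint _ fun x => convKernel ψ x y
  rw [cint_smul_measure_of_isBC c (.zeroAtInfty ψ), h, funext h1]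
  exact (cint_const_mul _ _ _).symm

theorem IsConv.smul_right {a b κ : M (G ⧸ H)} (c : ℂ) (h : IsConv a b κ) :
    IsConv a (c • b) (c • κ) := by
  intro ψ
  rw [cint_smul_measure_of_isBC c (.zeroAtInfty ψ), h]
  exact (cint_smul_measure_of_isBC c (isBC_cint_convKernel a ψ)).symm

/-- `κ` is the image of `a` under the reflection `xH ↦ x⁻¹H`, averaged over `H`. -/
def IsReflection (a κ : M (G ⧸ H)) : Prop :=
  ∀ ψ : C₀(G ⧸ H, ℂ), cint (κ : ComplexMeasure (G ⧸ H)) ψ =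
    cint (a : ComplexMeasure (G ⧸ H)) (involKernel ψ)

/-- Separates the conjugation from a complex-linear relation, to which `M.induction` applies. -/
theorem isInvol_iff (a κ : M (G ⧸ H)) : IsInvol a κ ↔ IsReflection (conjM a) κ := Iff.rfl

theorem IsReflection.add {a a' κ κ' : M (G ⧸ H)} (h : IsReflection a κ)
    (h' : IsReflection a' κ') : IsReflection (a + a') (κ + κ') := by
  intro ψ
  rw [cint_add_measure_of_isBC (.zeroAtInfty ψ), h, h',
    cint_add_measure_of_isBC (isBC_involKernel (.zeroAtInfty ψ))]

theorem IsReflection.smul {a κ : M (G ⧸ H)} (c : ℂ) (h : IsReflection a κ) :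
    IsReflection (c • a) (c • κ) := by
  intro ψ
  rw [cint_smul_measure_of_isBC c (.zeroAtInfty ψ), h,
    cint_smul_measure_of_isBC c (isBC_involKernel (.zeroAtInfty ψ))]

theorem IsReflection.conjM {a κ : M (G ⧸ H)} (h : IsReflection a κ) :
    IsReflection (conjM a) (conjM κ) := by
  intro ψ
  rw [cint_conjM (.zeroAtInfty ψ), cint_conjM (isBC_involKernel (.zeroAtInfty ψ))]
  congr 1
  -- Testing against the conjugate function moves the conjugation off the measure.
  refine (h (star ψ)).trans ?_
  congr 1
  funext x
  exact involKernel_conj ψ x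

variable [LocallyCompactSpace G]

/-- For positive `a` and `b` the iterated integral is a positive functional of `ψ` bounded by `‖a‖ *
‖b‖`. -/
theorem exists_isConv (a b : M (G ⧸ H)) : ∃ κ, IsConv a b κ := by
  induction a using M.induction with
  | hadd a a' ha ha' =>
    obtain ⟨κ, h⟩ := ha
    obtain ⟨κ', h'⟩ := ha'
    exact ⟨_, h.add_left h'⟩
  | hsmul c a ha =>
    obtain ⟨κ, h⟩ := ha
    exact ⟨_, h.smul_left c⟩
  | hpos μ =>
    induction b using M.induction with
    | hadd b b' hb hb' =>
      obtain ⟨κ, h⟩ := hb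
      obtain ⟨κ', h'⟩ := hb'
      exact ⟨_, h.add_right h'⟩
    | hsmul c b hb =>
      obtain ⟨κ, h⟩ := hb
      exact ⟨_, h.smul_right c⟩
    | hpos μ' =>
      let Λ : C₀(G ⧸ H, ℂ) →ₗ[ℂ] ℂ :=
        { toFun := fun ψ => cint (ofMeasure μ' : ComplexMeasure (G ⧸ H)) fun y =>
            cint (ofMeasure μ : ComplexMeasure (G ⧸ H)) fun x => convKernel ψ x y
          map_add' := fun ψ φ => by
            rw [← cint_add_of_isBC (isBC_cint_convKernel _ ψ) (isBC_cint_convKernel _ φ)]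
            congr 1
            funext y
            rw [← cint_add_of_isBC ((isBC_convKernel (.zeroAtInfty ψ)).left y)
              ((isBC_convKernel (.zeroAtInfty φ)).left y)]
            congr 1
            funext x
            exact convKernel_add (.zeroAtInfty ψ) (.zeroAtInfty φ) x y
          map_smul' := fun c ψ => by
            rw [RingHom.id_apply, smul_eq_mul, ← cint_const_mul]
            congr 1
            funext y
            rw [← cint_const_mul]
            congr 1
            funext x
            exact convKernel_smul c ψ x y }
      refine exists_cint_eq_of_nonneg Λ (C := ‖ofMeasure μ‖ * ‖ofMeasure μ'‖)
        (norm_cint_cint_convKernel_le _ _) fun ψ hψ => ?_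
      change ∃ r : ℝ, 0 ≤ r ∧ (cint (ofMeasure μ' : ComplexMeasure (G ⧸ H)) fun y =>
        cint (ofMeasure μ : ComplexMeasure (G ⧸ H)) fun x => convKernel ψ x y) = r
      simp_rw [cint_ofMeasure]
      exact exists_integral_eq_ofReal _ fun y => exists_integral_eq_ofReal _ fun x =>
        exists_convKernel_eq_ofReal hψ x y

theorem exists_isReflection (a : M (G ⧸ H)) : ∃ κ, IsReflection a κ := by
  induction a using M.induction with
  | hadd a a' ha ha' =>
    obtain ⟨κ, h⟩ := ha
    obtain ⟨κ', h'⟩ := ha'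
    exact ⟨_, h.add h'⟩
  | hsmul c a ha =>
    obtain ⟨κ, h⟩ := ha
    exact ⟨_, h.smul c⟩
  | hpos μ =>
    let Λ : C₀(G ⧸ H, ℂ) →ₗ[ℂ] ℂ :=
      { toFun := fun ψ => cint (ofMeasure μ : ComplexMeasure (G ⧸ H)) (involKernel ψ)
        map_add' := fun ψ φ => by
          rw [← cint_add_of_isBC (isBC_involKernel (.zeroAtInfty ψ))
            (isBC_involKernel (.zeroAtInfty φ))]
          congr 1
          funext x
          exact involKernel_add (.zeroAtInfty ψ) (.zeroAtInfty φ) x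
        map_smul' := fun c ψ => by
          rw [RingHom.id_apply, smul_eq_mul, ← cint_const_mul]
          congr 1
          funext x
          exact involKernel_smul c ψ x }
    refine exists_cint_eq_of_nonneg Λ (C := ‖ofMeasure μ‖) (fun ψ => ?_) fun ψ hψ => ?_
    · exact (norm_cint_le_norm _ (norm_involKernel_le ψ)).trans_eq (mul_comm _ _)
    · change ∃ r : ℝ, 0 ≤ r ∧ cint (ofMeasure μ : ComplexMeasure (G ⧸ H)) (involKernel ψ) = r
      rw [cint_ofMeasure]
      exact exists_integral_eq_ofReal _ (exists_involKernel_eq_ofReal hψ)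

theorem isConv_conv (a b : M (G ⧸ H)) : IsConv a b (conv a b) :=
  Classical.epsilon_spec (exists_isConv a b)

theorem cint_conv (a b : M (G ⧸ H)) (ψ : C₀(G ⧸ H, ℂ)) :
    cint (conv a b : ComplexMeasure (G ⧸ H)) ψ =
      cint (b : ComplexMeasure (G ⧸ H)) fun y =>
        cint (a : ComplexMeasure (G ⧸ H)) fun x => convKernel ψ x y :=
  isConv_conv a b ψ

theorem isInvol_invol (a : M (G ⧸ H)) : IsInvol a (invol a) :=
  Classical.epsilon_spec (exists_isReflection (conjM a))

theorem isConv_iff (a b κ : M (G ⧸ H)) : IsConv a b κ ↔ κ = conv a b := by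
  refine ⟨fun h => ext_of_forall_zeroAtInfty fun ψ => ?_, fun h => h ▸ isConv_conv a b⟩
  rw [h, isConv_conv a b]

theorem isReflection_unique {a κ κ' : M (G ⧸ H)} (h : IsReflection a κ)
    (h' : IsReflection a κ') : κ = κ' :=
  ext_of_forall_zeroAtInfty fun ψ => by rw [h, h']

theorem isInvol_iff_eq_invol (a κ : M (G ⧸ H)) : IsInvol a κ ↔ κ = invol a :=
  ⟨fun h => isReflection_unique ((isInvol_iff a κ).1 h)
    ((isInvol_iff a _).1 (isInvol_invol a)), by rintro rfl; exact isInvol_invol a⟩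

end Convolution

/-! ### Identities between the kernels -/

section KernelIdentities

variable {G : Type*} [Group G] [TopologicalSpace G] [IsTopologicalGroup G] [T2Space G]
  {H : Subgroup G} [CompactSpace H] [MeasurableSpace H] [BorelSpace H]

theorem cint_haarM_mul_right (f : H → ℂ) (k : H) :
    cint (haarM H : ComplexMeasure H) (fun h => f (h * k)) =
      cint (haarM H : ComplexMeasure H) f := by
  simp only [cint_haarM]
  exact integral_mul_right_eq_self f k

theorem cint_haarM_inv (f : H → ℂ) :
    cint (haarM H : ComplexMeasure H) (fun h => f h⁻¹) =
      cint (haarM H : ComplexMeasure H) f := by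
  simp only [cint_haarM]
  exact integral_inv_eq_self f _

theorem cint_haarM_const (c : ℂ) : cint (haarM H : ComplexMeasure H) (fun _ => c) = c := by
  simp [cint_haarM]

theorem convKernel_smul_left {f : G ⧸ H → ℂ} (g : G) (x y : G ⧸ H) :
    convKernel (fun z => f (g • z)) x y = convKernel f (g • x) y := by
  obtain ⟨x, rfl⟩ := QuotientGroup.mk_surjective x
  change _ = convKernel f ((g * x : G) : G ⧸ H) y
  simp only [convKernel_mk, smul_smul, mul_assoc]

/-- Since `g(xh)⁻¹ = (xhg⁻¹)⁻¹`, right invariance of `dh` absorbs `g`. This makes every `invol a`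
invariant. -/
theorem involKernel_smul_left {f : G ⧸ H → ℂ} {g : G} (hg : g ∈ H) (x : G ⧸ H) :
    involKernel (fun z => f (g • z)) x = involKernel f x := by
  obtain ⟨x, rfl⟩ := QuotientGroup.mk_surjective x
  rw [involKernel_mk, involKernel_mk,
    ← cint_haarM_mul_right (fun h : H => f (((x * h)⁻¹ : G) : G ⧸ H)) ⟨g, hg⟩⁻¹]
  congr 1
  funext h
  change f ((g * (x * h)⁻¹ : G) : G ⧸ H) = f (((x * (h * g⁻¹))⁻¹ : G) : G ⧸ H)
  congr 2
  group

/-- Both sides integrate `f(xkyhzH)` over `k` and `h` in `H`, in opposite orders. -/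
theorem convKernel_convKernel {f : G ⧸ H → ℂ} (hf : IsBC f) (x : G ⧸ H) (y : G) (z : G ⧸ H) :
    convKernel (fun w => convKernel f w z) x y =
      cint (haarM H : ComplexMeasure H) fun h => convKernel f x ((y * h) • z) := by
  obtain ⟨x, rfl⟩ := QuotientGroup.mk_surjective x
  obtain ⟨z, rfl⟩ := QuotientGroup.mk_surjective z
  have hF : IsBC (Function.uncurry fun h k : H => f ((x * k * (y * h * z) : G) : G ⧸ H)) :=
    hf.comp (g := fun p : H × H => ((x * p.2 * (y * p.1 * z) : G) : G ⧸ H))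
      (QuotientGroup.continuous_mk.comp (by fun_prop))
  have h1 : ∀ h : H, convKernel f x (((y * h * z : G)) : G ⧸ H) =
      cint (haarM H : ComplexMeasure H) fun k => f ((x * k * (y * h * z) : G) : G ⧸ H) :=
    fun h => convKernel_mk _ _ _
  have h2 : ∀ k : H, convKernel f ((x * k * y : G) : G ⧸ H) (z : G ⧸ H) =
      cint (haarM H : ComplexMeasure H) fun h => f ((x * k * (y * h * z) : G) : G ⧸ H) := by
    intro k
    rw [convKernel_mk]
    congr 1
    funext h
    change f ((x * k * y * h * z : G) : G ⧸ H) = _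
    simp only [mul_assoc]
  rw [convKernel_mk]
  change cint _ (fun k : H => convKernel f ((x * k * y : G) : G ⧸ H) (z : G ⧸ H)) =
    cint _ fun h : H => convKernel f x (((y * h * z : G)) : G ⧸ H)
  rw [funext h1, funext h2]
  exact cint_cint_swap (haarM H) (haarM H) hF

/-- After inverting `k`, the inner integrand is `f(kxhH) = f(kxH)`, so the variable `h` drops out.
-/
theorem involKernel_involKernel (f : G ⧸ H → ℂ) (x : G ⧸ H) :
    involKernel (involKernel f) x =
      cint (haarM H : ComplexMeasure H) fun h => f ((h : G) • x) := by
  obtain ⟨x, rfl⟩ := QuotientGroup.mk_surjective x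
  have h1 : ∀ h : H, involKernel f (((x * h)⁻¹ : G) : G ⧸ H) =
      cint (haarM H : ComplexMeasure H) fun k => f ((k : G) • (x : G ⧸ H)) := by
    intro h
    rw [involKernel_mk, ← cint_haarM_inv]
    congr 1
    funext k
    congr 1
    change _ = ((k * x : G) : G ⧸ H)
    rw [QuotientGroup.eq]
    have : (((x * h)⁻¹ * ((k⁻¹ : H) : G))⁻¹)⁻¹ * (k * x) = ((h⁻¹ : H) : G) := by
      push_cast
      group
    rw [this]
    exact h⁻¹.2
  rw [involKernel_mk, funext h1, cint_haarM_const]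

/-- Both sides integrate `f((xk)⁻¹ly⁻¹H)` over `k` and `l`. On the right the variable `h` is
absorbed by translating `l`; on the left `l` appears after an inversion. -/
theorem convKernel_involKernel {f : G ⧸ H → ℂ} (hf : IsBC f) (x : G ⧸ H) (y : G) :
    convKernel (involKernel f) y x =
      cint (haarM H : ComplexMeasure H) fun h =>
        involKernel (fun w => convKernel f w (((y * h)⁻¹ : G) : G ⧸ H)) x := by
  obtain ⟨x, rfl⟩ := QuotientGroup.mk_surjective x
  have hF : IsBC (Function.uncurry fun h k : H =>
      f (((x * k)⁻¹ * h * y⁻¹ : G) : G ⧸ H)) :=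
    hf.comp (g := fun p : H × H => (((x * p.2)⁻¹ * p.1 * y⁻¹ : G) : G ⧸ H))
      (QuotientGroup.continuous_mk.comp (by fun_prop))
  have h1 : ∀ h : H, involKernel (fun w => convKernel f w (((y * h)⁻¹ : G) : G ⧸ H)) x =
      cint (haarM H : ComplexMeasure H) fun k => cint (haarM H : ComplexMeasure H) fun l =>
        f (((x * k)⁻¹ * l * y⁻¹ : G) : G ⧸ H) := by
    intro h
    rw [involKernel_mk]
    congr 1
    funext k
    rw [convKernel_mk, ← cint_haarM_mul_right _ h]
    congr 1
    funext l
    change f (((x * k)⁻¹ * (l * h) * (y * h)⁻¹ : G) : G ⧸ H) = _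
    congr 2
    group
  have h2 : convKernel (involKernel f) y (x : G ⧸ H) =
      cint (haarM H : ComplexMeasure H) fun h => cint (haarM H : ComplexMeasure H) fun k =>
        f (((x * k)⁻¹ * h * y⁻¹ : G) : G ⧸ H) := by
    rw [convKernel_mk, ← cint_haarM_inv]
    congr 1
    funext h
    change involKernel f ((y * (h⁻¹ : H) * x : G) : G ⧸ H) = _
    rw [involKernel_mk]
    congr 1
    funext k
    congr 2
    push_cast
    group
  rw [funext h1, cint_haarM_const, h2]
  exact (cint_cint_swap (haarM H) (haarM H) hF).symm

end KernelIdentities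

/-! ### Measures invariant under `H` -/

section Invariance

variable {G : Type*} [Group G] [TopologicalSpace G] [IsTopologicalGroup G] {H : Subgroup G}

theorem exists_eq_smul (ψ : C₀(G ⧸ H, ℂ)) (g : G) :
    ∃ φ : C₀(G ⧸ H, ℂ), ∀ x, φ x = ψ (g • x) :=
  ⟨ψ.comp (Homeomorph.smul g : (G ⧸ H) ≃ₜ (G ⧸ H)).toCocompactMap, fun _ => rfl⟩

variable [T2Space G] [CompactSpace H] [MeasurableSpace (G ⧸ H)] [BorelSpace (G ⧸ H)]

theorem mem_invariantMeasures_iff {a : M (G ⧸ H)} :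
    a ∈ invariantMeasures H ↔ ∀ h ∈ H, mapM (Homeomorph.smul h) a = a := by
  constructor
  · intro ha h hh
    ext E hE
    rw [mapM_apply _ _ hE]
    have := ha h⁻¹ (H.inv_mem hh) E hE
    rwa [← Set.preimage_smul] at this
  · intro ha h hh E hE
    have := congrArg (fun ν : M (G ⧸ H) => (ν : ComplexMeasure (G ⧸ H)) E)
      (ha h⁻¹ (H.inv_mem hh))
    simp only [mapM_apply _ _ hE] at this
    rw [← this]
    congr 1
    exact (Set.preimage_smul_inv h E).symm

theorem isClosed_invariantMeasures : IsClosed (invariantMeasures H : Set (M (G ⧸ H))) := by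
  have : (invariantMeasures H : Set (M (G ⧸ H))) = ⋂ h ∈ H, ⋂ (E : Set (G ⧸ H)),
      ⋂ (_ : MeasurableSet E), {a : M (G ⧸ H) | (a : ComplexMeasure (G ⧸ H)) (h • E) =
        (a : ComplexMeasure (G ⧸ H)) E} := by
    ext a
    simp only [Set.mem_iInter]
    rfl
  rw [this]
  exact isClosed_biInter fun h _ => isClosed_iInter fun E => isClosed_iInter fun _ =>
    isClosed_eq (continuous_apply _) (continuous_apply _)

theorem cint_smul_of_mem_invariantMeasures {a : M (G ⧸ H)} (ha : a ∈ invariantMeasures H)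
    (h : H) (f : G ⧸ H → ℂ) :
    cint (a : ComplexMeasure (G ⧸ H)) (fun x => f ((h : G) • x)) =
      cint (a : ComplexMeasure (G ⧸ H)) f := by
  have := cint_mapM (Homeomorph.smul (h : G)) a f
  rw [mem_invariantMeasures_iff.1 ha h h.2] at this
  exact this.symm

end Invariance

/-! ### The Banach algebra and its involution -/

section Algebra

variable {G : Type*} [Group G] [TopologicalSpace G] [IsTopologicalGroup G] [T2Space G]
  {H : Subgroup G} [CompactSpace H] [MeasurableSpace H] [BorelSpace H]
  [MeasurableSpace (G ⧸ H)] [BorelSpace (G ⧸ H)] [LocallyCompactSpace G]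

theorem norm_conv_le (a b : M (G ⧸ H)) : ‖conv a b‖ ≤ ‖a‖ * ‖b‖ := by
  refine norm_le_of_forall_zeroAtInfty _ (by positivity) fun ψ => ?_
  rw [cint_conv]
  exact norm_cint_cint_convKernel_le a b ψ

theorem conv_assoc (a b c : M (G ⧸ H)) : conv (conv a b) c = conv a (conv b c) := by
  refine ext_of_forall_zeroAtInfty fun ψ => ?_
  -- Naming the partial integrals as elements `φ` and `χ` of `C₀` permits a second use of the
  -- relation defining `conv`.
  obtain ⟨φ, hφ⟩ := exists_eq_cint_convKernel a ψ
  rw [cint_conv, cint_conv, ← funext hφ, cint_conv]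
  congr 1
  funext z
  obtain ⟨χ, hχ⟩ := exists_eq_convKernel_left ψ z
  rw [← funext hχ, cint_conv]
  congr 1
  funext y
  obtain ⟨y, rfl⟩ := QuotientGroup.mk_surjective y
  have hF : IsBC (Function.uncurry fun (h : H) x => convKernel ψ x ((y * h) • z)) :=
    (isBC_convKernel (.zeroAtInfty ψ)).comp
      (by fun_prop : Continuous fun p : H × (G ⧸ H) => (p.2, (y * (p.1 : G)) • z))
  rw [convKernel_mk]
  simp_rw [hφ]
  rw [funext hχ, ← cint_cint_swap (haarM H) a hF]
  congr 1
  funext x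
  exact convKernel_convKernel (.zeroAtInfty ψ) x y z

theorem isBanachAlgebra_conv : IsBanachAlgebra (M (G ⧸ H)) conv where
  complete := inferInstance
  add_mul a b c := ((isConv_iff _ _ _).1 ((isConv_conv a c).add_left (isConv_conv b c))).symm
  mul_add a b c := ((isConv_iff _ _ _).1 ((isConv_conv a b).add_right (isConv_conv a c))).symm
  smul_mul z a b := ((isConv_iff _ _ _).1 ((isConv_conv a b).smul_left z)).symm
  mul_smul z a b := ((isConv_iff _ _ _).1 ((isConv_conv a b).smul_right z)).symm
  mul_assoc := conv_assoc
  norm_mul_le := norm_conv_le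

theorem conjM_conv (a b : M (G ⧸ H)) : conjM (conv a b) = conv (conjM a) (conjM b) := by
  refine (isConv_iff _ _ _).1 fun ψ => ?_
  have hs : ∀ y, IsBC fun x => convKernel ψ x y := (isBC_convKernel (.zeroAtInfty ψ)).left
  change _ = cint (conjM b : ComplexMeasure (G ⧸ H)) fun y =>
    cint (conjM a : ComplexMeasure (G ⧸ H)) fun x => convKernel ψ x y
  rw [cint_conjM (isBC_cint_convKernel _ ψ), cint_conjM (.zeroAtInfty ψ)]
  congr 1
  refine (cint_conv a b (star ψ)).trans ?_
  congr 1
  funext y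
  rw [cint_conjM (hs y), Complex.conj_conj]
  congr 1
  funext x
  exact convKernel_conj ψ x y

/-- One Fubini exchange between `a` and `b` reverses the order of the factors; what remains is
`convKernel_involKernel`. -/
theorem IsReflection.conv {a b κ κ' : M (G ⧸ H)} (h : IsReflection a κ)
    (h' : IsReflection b κ') : IsReflection (conv a b) (conv κ' κ) := by
  intro ψ
  obtain ⟨φ, hφ⟩ := exists_eq_cint_convKernel κ' ψ
  obtain ⟨χ, hχ⟩ := exists_eq_involKernel ψ
  have hφ' : ∀ y, φ y = cint (b : ComplexMeasure (G ⧸ H))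
      (involKernel fun w => convKernel ψ w y) := by
    intro y
    obtain ⟨ξ, hξ⟩ := exists_eq_convKernel_left ψ y
    rw [hφ, ← funext hξ, h']
  rw [cint_conv, ← funext hφ, h, ← funext hχ, cint_conv,
    cint_cint_swap a b (isBC_convKernel (.zeroAtInfty χ))]
  congr 1
  funext y
  obtain ⟨y, rfl⟩ := QuotientGroup.mk_surjective y
  have hF : IsBC (Function.uncurry fun (h : H) x =>
      involKernel (fun w => convKernel ψ w (((y * h)⁻¹ : G) : G ⧸ H)) x) :=
    (isBC_uncurry_involKernel (isBC_convKernel (.zeroAtInfty ψ))).comp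
      (g := fun p : H × (G ⧸ H) => (p.2, (((y * (p.1 : G))⁻¹ : G) : G ⧸ H)))
      (continuous_snd.prodMk (continuous_mk_inv.comp (by fun_prop)))
  rw [involKernel_mk]
  simp_rw [hφ']
  rw [funext hχ, ← cint_cint_swap (haarM H) b hF]
  congr 1
  funext x
  exact (convKernel_involKernel (.zeroAtInfty ψ) x y).symm

theorem invol_conv (a b : M (G ⧸ H)) : invol (conv a b) = conv (invol b) (invol a) := by
  refine ((isInvol_iff_eq_invol _ _).1 ((isInvol_iff _ _).2 ?_)).symm
  rw [conjM_conv]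
  exact IsReflection.conv (isInvol_invol a) (isInvol_invol b)

theorem invol_add (a b : M (G ⧸ H)) : invol (a + b) = invol a + invol b := by
  refine ((isInvol_iff_eq_invol _ _).1 ((isInvol_iff _ _).2 ?_)).symm
  rw [conjM_add]
  exact IsReflection.add (isInvol_invol a) (isInvol_invol b)

theorem invol_smul (z : ℂ) (a : M (G ⧸ H)) : invol (z • a) = conj z • invol a := by
  refine ((isInvol_iff_eq_invol _ _).1 ((isInvol_iff _ _).2 ?_)).symm
  rw [conjM_smul]
  exact IsReflection.smul _ (isInvol_invol a)

theorem norm_invol_le (a : M (G ⧸ H)) : ‖invol a‖ ≤ ‖a‖ := by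
  refine norm_le_of_forall_zeroAtInfty _ (norm_nonneg _) fun ψ => ?_
  rw [(isInvol_iff _ _).1 (isInvol_invol a) ψ]
  refine (norm_cint_le_norm _ (norm_involKernel_le ψ)).trans ?_
  rw [mul_comm]
  gcongr
  exact norm_conjM_le a

/-- Translation by `g` enters the kernel only through `x`, so invariance of a product depends on its
left factor alone. -/
theorem mapM_conv (g : G) (a b : M (G ⧸ H)) :
    mapM (Homeomorph.smul g) (conv a b) = conv (mapM (Homeomorph.smul g) a) b := by
  refine (isConv_iff _ _ _).1 fun ψ => ?_
  obtain ⟨φ, hφ⟩ := exists_eq_smul ψ g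
  rw [cint_mapM]
  change cint _ (fun x => ψ (g • x)) = _
  rw [← funext hφ, cint_conv]
  congr 1
  funext y
  rw [cint_mapM, funext hφ]
  congr 1
  funext x
  exact convKernel_smul_left g x y

theorem conv_mem_invariantMeasures {a : M (G ⧸ H)} (ha : a ∈ invariantMeasures H)
    (b : M (G ⧸ H)) : conv a b ∈ invariantMeasures H := by
  rw [mem_invariantMeasures_iff] at ha ⊢
  intro h hh
  rw [mapM_conv, ha h hh]

theorem invol_mem_invariantMeasures (a : M (G ⧸ H)) : invol a ∈ invariantMeasures H := by
  rw [mem_invariantMeasures_iff]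
  intro h hh
  refine (isInvol_iff_eq_invol _ _).1 ((isInvol_iff _ _).2 fun ψ => ?_)
  obtain ⟨φ, hφ⟩ := exists_eq_smul ψ h
  rw [cint_mapM]
  change cint _ (fun x => ψ (h • x)) = _
  rw [← funext hφ, (isInvol_iff _ _).1 (isInvol_invol a) φ, funext hφ]
  congr 1
  funext x
  exact involKernel_smul_left hh x

theorem invol_invol {a : M (G ⧸ H)} (ha : a ∈ invariantMeasures H) : invol (invol a) = a := by
  have h1 : IsReflection a (conjM (invol a)) := by
    have := IsReflection.conjM ((isInvol_iff _ _).1 (isInvol_invol a))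
    rwa [conjM_conjM] at this
  refine ((isInvol_iff_eq_invol _ _).1 ((isInvol_iff _ _).2 fun ψ => ?_)).symm
  obtain ⟨χ, hχ⟩ := exists_eq_involKernel ψ
  rw [← funext hχ, h1, funext hχ, funext (involKernel_involKernel ψ)]
  have hF : IsBC (Function.uncurry fun (h : H) (x : G ⧸ H) => ψ ((h : G) • x)) :=
    (IsBC.zeroAtInfty ψ).comp (by fun_prop : Continuous fun p : H × (G ⧸ H) => (p.1 : G) • p.2)
  -- The double reflection is an average over `H`; after the exchange each translate has the same
  -- integral, by invariance of `a`.
  rw [cint_cint_swap (haarM H) a hF]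
  simp_rw [fun h : H => cint_smul_of_mem_invariantMeasures ha h ψ]
  exact (cint_haarM_const _).symm

theorem norm_invol {a : M (G ⧸ H)} (ha : a ∈ invariantMeasures H) : ‖invol a‖ = ‖a‖ := by
  refine (norm_invol_le a).antisymm ?_
  have := norm_invol_le (invol a)
  rwa [invol_invol ha] at this

end Algebra

end CosetMeasure

end

theorem mainTheorem1 {G : Type*} [Group G] [TopologicalSpace G] [IsTopologicalGroup G]
    [LocallyCompactSpace G] [T2Space G] (H : Subgroup G) [CompactSpace H]
    [MeasurableSpace H] [BorelSpace H] [MeasurableSpace (G ⧸ H)] [BorelSpace (G ⧸ H)] :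
    (∀ lam lam' κ : CosetMeasure.M (G ⧸ H),
      CosetMeasure.IsConv lam lam' κ ↔ κ = CosetMeasure.conv lam lam') ∧
    (∀ lam κ : CosetMeasure.M (G ⧸ H),
      CosetMeasure.IsInvol lam κ ↔ κ = CosetMeasure.invol lam) ∧
    CosetMeasure.IsBanachAlgebra (CosetMeasure.M (G ⧸ H)) CosetMeasure.conv ∧
    IsClosed (CosetMeasure.invariantMeasures H : Set (CosetMeasure.M (G ⧸ H))) ∧
    ∃ (hconv : ∀ lam ∈ CosetMeasure.invariantMeasures H,
          ∀ lam' ∈ CosetMeasure.invariantMeasures H,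
            CosetMeasure.conv lam lam' ∈ CosetMeasure.invariantMeasures H)
      (hinv : ∀ lam ∈ CosetMeasure.invariantMeasures H,
          CosetMeasure.invol lam ∈ CosetMeasure.invariantMeasures H),
      CosetMeasure.IsBanachStarAlgebra (CosetMeasure.invariantMeasures H)
        (fun lam lam' => ⟨CosetMeasure.conv lam.1 lam'.1, hconv _ lam.2 _ lam'.2⟩)
        (fun lam => ⟨CosetMeasure.invol lam.1, hinv _ lam.2⟩) := by
  have hA := CosetMeasure.isBanachAlgebra_conv (H := H)
  have hclosed := CosetMeasure.isClosed_invariantMeasures (H := H)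
  refine ⟨CosetMeasure.isConv_iff, CosetMeasure.isInvol_iff_eq_invol, hA, hclosed,
    fun _ ha b _ => CosetMeasure.conv_mem_invariantMeasures ha b,
    fun a _ => CosetMeasure.invol_mem_invariantMeasures a, ?_⟩
  exact
    { complete := hclosed.completeSpace_coe
      add_mul := fun a b c => Subtype.ext (hA.add_mul a b c)
      mul_add := fun a b c => Subtype.ext (hA.mul_add a b c)
      smul_mul := fun z a b => Subtype.ext (hA.smul_mul z a b)
      mul_smul := fun z a b => Subtype.ext (hA.mul_smul z a b)
      mul_assoc := fun a b c => Subtype.ext (hA.mul_assoc a b c)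
      norm_mul_le := fun a b => hA.norm_mul_le a b
      inv_add := fun a b => Subtype.ext (CosetMeasure.invol_add _ _)
      inv_smul := fun z a => Subtype.ext (CosetMeasure.invol_smul _ _)
      inv_inv := fun a => Subtype.ext (CosetMeasure.invol_invol a.2)
      inv_mul := fun a b => Subtype.ext (CosetMeasure.invol_conv _ _)
      norm_inv := fun a => CosetMeasure.norm_invol a.2 }
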